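/- Let $(a_j)_{j\ge 1}$ be a sequence of non-negative integers, and consider components (indecomposable objects) such that, for every $j\ge 1$, exactly $a_j$ distinct components have size $j$. For $n\ge 0$ let $c_n$ be the number of multisets of components, with unlimited repetition allowed, whose total size (the sum of the sizes of the components, counted with multiplicity) is $n$; equivalently, $\sum_{n\ge 0} c_n x^n=\prod_{j\ge 1}(1-x^j)^{-a_j}$. Assume that $a_j=Kj^{r-1}y^j+O(y^{\nu j})$ as $j\to\infty$, where $K>0$, $r>0$, $y>1$ and $\nu\in(0,1)$ are real constants. Then there are positive constants $\kappa_1,\kappa_2$ (not depending on $n$) such that, as $n\to\infty$, $$c_n\sim\kappa_1\, y^n\, n^{-\frac{r+2}{2(r+1)}}\exp\left(\kappa_2\, n^{r/(r+1)}\right).$$ Moreover, $\kappa_2=\frac{r+1}{r}\left(K\,\Gamma(r+1)\right)^{1/(r+1)}$, where $\Gamma$ is the gamma function. -/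

import Mathlib

open Filter Asymptotics

/-- The indecomposable components: exactly `a j` of them have size `j`, for every `j ≥ 1`
(the value `a 0` plays no role). -/
abbrev Component (a : ℕ → ℕ) : Type := (j : ℕ+) × Fin (a j)

/-- The size of a component. -/
def Component.size {a : ℕ → ℕ} (c : Component a) : ℕ := c.1

/-- The total size of a multiset of components. -/
def totalSize {a : ℕ → ℕ} (m : Multiset (Component a)) : ℕ :=
  (m.map Component.size).sum

/-- The multisets of components of total size `n`; components may be repeated. -/
def multisetsOfSize (a : ℕ → ℕ) (n : ℕ) : Set (Multiset (Component a)) :=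
  {m | totalSize m = n}

/-- The number `c_n` of multisets of total size `n`. -/
noncomputable def multisetCount (a : ℕ → ℕ) (n : ℕ) : ℕ :=
  (multisetsOfSize a n).ncard

/-- There are only finitely many multisets of a given total size, so that `multisetCount`
is their actual number. -/
theorem multisetsOfSize_finite (a : ℕ → ℕ) (n : ℕ) : (multisetsOfSize a n).Finite := by
  classical
  have hfin : {c : Component a | c.size ≤ n}.Finite := by
    have h1 : (Set.Iic n).Finite := Set.finite_Iic n
    have h2 : {j : ℕ+ | (j : ℕ) ≤ n}.Finite :=
      h1.preimage (PNat.coe_injective.injOn)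
    refine Set.Finite.subset
      (h2.toFinset.sigma fun j => (Finset.univ : Finset (Fin (a j)))).finite_toSet ?_
    intro c hc
    simpa [Component.size] using hc
  refine Set.Finite.subset (Set.finite_Iic (n • hfin.toFinset.val)) ?_
  intro m hm
  have hm' : (m.map Component.size).sum = n := hm
  have hle : ∀ c ∈ m, c.size ≤ n := fun c hc => by
    rw [← hm']
    exact Multiset.single_le_sum (fun _ _ => Nat.zero_le _) _ (Multiset.mem_map_of_mem _ hc)
  have hcard : m.card ≤ n := by
    have h := Multiset.card_nsmul_le_sum (s := m.map Component.size) (a := 1) (by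
      intro x hx
      obtain ⟨c, -, rfl⟩ := Multiset.mem_map.1 hx
      exact c.1.pos)
    simpa [hm'] using h
  change m ≤ n • hfin.toFinset.val
  rw [Multiset.le_iff_count]
  intro c
  by_cases hc : c ∈ m
  · have h1 : Multiset.count c hfin.toFinset.val = 1 :=
      Multiset.count_eq_one_of_mem hfin.toFinset.nodup (by simpa using hle c hc)
    rw [Multiset.count_nsmul, h1, mul_one]
    exact (Multiset.count_le_card c m).trans hcard
  · simp [Multiset.count_eq_zero_of_notMem hc]

/-! The proof is a saddle point analysis of the generating function at its singularity `x = 1/y`.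
Put `b n = c_n / y ^ n`. Its generating function is `exp (∑ l m x ^ m)`, where `l m = (∑ j ∣ m, j
a_j) / (m y ^ m)`. The divisor `j = m` contributes `K m ^ (r - 1)` up to a geometrically small
error. Proper divisors are at most `m / 2`, so they contribute a summable sequence as well.

With `x = exp (-s)`, the logarithm is therefore `K ∑ m ^ (r - 1) exp (-m s)` plus a series that
stays continuous up to `s = 0`. Poisson summation shows that the first sum is `Γ(r) s ^ (-r) + E +
O(s)`, uniformly for `|im s| ≤ π` (`exists_polylogSeries_expansion`). The logarithm is thus `A s ^
(-r) + R s` with `A = K Γ(r)`, where `R` is bounded near the imaginary segment and has a limit at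
`0`.

Cauchy's formula on `|x| = exp (-σ)` gives `b n`. Choosing `r A σ ^ (-r - 1) = n` removes the linear
term of the exponent. At the scale `θ = σ ^ (1 + r / 2) u` the integrand tends to a Gaussian. Since
the expansion holds on the whole circle, one integrable majorant covers it without separate minor
arcs (`tendsto_saddle_integral`). Solving for `σ` in terms of `n` produces the stated powers of `n`.

The product formula is never manipulated: the counting recurrence `mul_multisetCount` determines the
coefficients of the exponential. -/

/-! ### Counting multisets: the recurrence for `c_n`. -/

theorem totalSize_add {a : ℕ → ℕ} (m m' : Multiset (Component a)) :
    totalSize (m + m') = totalSize m + totalSize m' := by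
  simp [totalSize]

theorem totalSize_replicate {a : ℕ → ℕ} (k : ℕ) (c : Component a) :
    totalSize (Multiset.replicate k c) = k * c.size := by
  simp [totalSize]

theorem card_le_totalSize {a : ℕ → ℕ} (m : Multiset (Component a)) : m.card ≤ totalSize m := by
  have h := Multiset.card_nsmul_le_sum (s := m.map Component.size) (a := 1) (by
    intro x hx
    obtain ⟨c, -, rfl⟩ := Multiset.mem_map.1 hx
    exact c.1.pos)
  simpa [totalSize] using h

theorem size_le_totalSize {a : ℕ → ℕ} {m : Multiset (Component a)} {c : Component a}
    (hc : c ∈ m) : c.size ≤ totalSize m :=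
  Multiset.single_le_sum (fun _ _ => Nat.zero_le _) _ (Multiset.mem_map_of_mem _ hc)

theorem multisetCount_eq_card (a : ℕ → ℕ) (n : ℕ) :
    multisetCount a n = (multisetsOfSize_finite a n).toFinset.card :=
  Set.ncard_eq_toFinset_card _ _

theorem multisetCount_zero (a : ℕ → ℕ) : multisetCount a 0 = 1 := by
  rw [multisetCount, Set.ncard_eq_one]
  refine ⟨0, ?_⟩
  ext m
  simp only [multisetsOfSize, Set.mem_ofPred_eq, Set.mem_singleton_iff]
  constructor
  · intro h
    have := card_le_totalSize m
    rw [h] at this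
    simpa using this
  · rintro rfl
    simp [totalSize]

theorem components_finite (a : ℕ → ℕ) (n : ℕ) : {c : Component a | c.size ≤ n}.Finite := by
  have h2 : {j : ℕ+ | (j : ℕ) ≤ n}.Finite :=
    (Set.finite_Iic n).preimage (PNat.coe_injective.injOn)
  refine Set.Finite.subset
    (h2.toFinset.sigma fun j => (Finset.univ : Finset (Fin (a j)))).finite_toSet ?_
  intro c hc
  simpa [Component.size] using hc

theorem sum_components (a : ℕ → ℕ) (n : ℕ) (φ : ℕ → ℕ) :
    ∑ c ∈ (components_finite a n).toFinset, φ c.size = ∑ j ∈ Finset.Icc 1 n, a j * φ j := by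
  classical
  have hmaps : ∀ c ∈ (components_finite a n).toFinset, c.size ∈ Finset.Icc 1 n := by
    intro c hc
    have : c.size ≤ n := by simpa using hc
    exact Finset.mem_Icc.2 ⟨c.1.pos, this⟩
  rw [← Finset.sum_fiberwise_of_maps_to hmaps]
  refine Finset.sum_congr rfl fun j hj => ?_
  rw [Finset.mem_Icc] at hj
  rw [Finset.sum_congr rfl (g := fun _ => φ j) (fun c hc => by rw [(Finset.mem_filter.1 hc).2]),
    Finset.sum_const, smul_eq_mul]
  congr 1
  rw [← Fintype.card_fin (a j), ← Finset.card_univ]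
  symm
  refine Finset.card_bij (fun i _ => (Sigma.mk (j.toPNat hj.1) i : Component a)) ?_ ?_ ?_
  · intro i _
    simp only [Finset.mem_filter, Set.Finite.mem_toFinset, Set.mem_ofPred_eq]
    exact ⟨hj.2, rfl⟩
  · intro i _ i' _ h
    exact sigma_mk_injective (i := j.toPNat hj.1) h
  · intro c hc
    obtain ⟨-, rfl⟩ := Finset.mem_filter.1 hc
    exact ⟨c.2, Finset.mem_univ _, rfl⟩

/-- Adding `k` copies of `c` is a bijection from the multisets of size `n - k * c.size`. The case
split guards against truncated subtraction. -/
theorem card_multisets_count_ge (a : ℕ → ℕ) (n k : ℕ) (c : Component a) [DecidableEq (Component a)] :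
    ((multisetsOfSize_finite a n).toFinset.filter (fun m => k ≤ m.count c)).card =
      if k * c.size ≤ n then multisetCount a (n - k * c.size) else 0 := by
  split_ifs with h
  · rw [multisetCount_eq_card]
    symm
    refine Finset.card_bij (fun m _ => m + Multiset.replicate k c) ?_ ?_ ?_
    · intro m hm
      have hm' : totalSize m = n - k * c.size := by simpa [multisetsOfSize] using hm
      simp only [Finset.mem_filter, Set.Finite.mem_toFinset, multisetsOfSize, Set.mem_ofPred_eq,
        totalSize_add, totalSize_replicate, Multiset.count_add, Multiset.count_replicate_self]
      omega
    · intro m _ m' _ h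
      exact add_right_cancel h
    · intro m hm
      simp only [Finset.mem_filter, Set.Finite.mem_toFinset, multisetsOfSize,
        Set.mem_ofPred_eq] at hm
      have hle := Multiset.le_count_iff_replicate_le.1 hm.2
      refine ⟨m - Multiset.replicate k c, ?_, tsub_add_cancel_of_le hle⟩
      have h1 := totalSize_add (m - Multiset.replicate k c) (Multiset.replicate k c)
      rw [tsub_add_cancel_of_le hle, totalSize_replicate, hm.1] at h1
      simp only [Set.Finite.mem_toFinset, multisetsOfSize, Set.mem_ofPred_eq]
      omega
  · rw [Finset.card_eq_zero, Finset.filter_eq_empty_iff]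
    intro m hm hk
    have hm' : totalSize m = n := by simpa [multisetsOfSize] using hm
    have hle := Multiset.le_count_iff_replicate_le.1 hk
    have h1 := totalSize_add (m - Multiset.replicate k c) (Multiset.replicate k c)
    rw [tsub_add_cancel_of_le hle, totalSize_replicate, hm'] at h1
    omega

theorem sum_Icc_multiples {M : Type*} [AddCommMonoid M] (n : ℕ) (ψ : ℕ → ℕ → M) :
    ∑ j ∈ Finset.Icc 1 n, ∑ k ∈ Finset.Icc 1 n, (if k * j ≤ n then ψ j (k * j) else 0) =
      ∑ m ∈ Finset.Icc 1 n, ∑ j ∈ m.divisors, ψ j m := by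
  simp_rw [← Finset.sum_filter]
  rw [Finset.sum_sigma', Finset.sum_sigma']
  refine Finset.sum_bij' (fun x _ => ⟨x.2 * x.1, x.1⟩) (fun x _ => ⟨x.2, x.1 / x.2⟩)
    ?_ ?_ ?_ ?_ ?_
  · rintro ⟨j, k⟩ h
    simp only [Finset.mem_sigma, Finset.mem_filter, Finset.mem_Icc, Nat.mem_divisors] at h ⊢
    exact ⟨⟨Nat.mul_pos h.2.1.1 h.1.1, h.2.2⟩, Dvd.intro_left _ rfl,
      (Nat.mul_pos h.2.1.1 h.1.1).ne'⟩
  · rintro ⟨m, j⟩ h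
    simp only [Finset.mem_sigma, Finset.mem_filter, Finset.mem_Icc, Nat.mem_divisors] at h ⊢
    have hj := Nat.pos_of_dvd_of_pos h.2.1 h.1.1
    have hjm := Nat.le_of_dvd h.1.1 h.2.1
    exact ⟨⟨hj, hjm.trans h.1.2⟩, ⟨Nat.div_pos hjm hj, (Nat.div_le_self _ _).trans h.1.2⟩,
      by rw [Nat.div_mul_cancel h.2.1]; exact h.1.2⟩
  · rintro ⟨j, k⟩ h
    simp only [Finset.mem_sigma, Finset.mem_filter, Finset.mem_Icc] at h
    simp [Nat.mul_div_cancel _ (show 0 < j by omega)]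
  · rintro ⟨m, j⟩ h
    simp only [Finset.mem_sigma, Finset.mem_Icc, Nat.mem_divisors] at h
    simp [Nat.div_mul_cancel h.2.1]
  · rintro ⟨j, k⟩ h
    rfl

/-- The recurrence obtained by logarithmic differentiation of the generating function. -/
theorem mul_multisetCount (a : ℕ → ℕ) (n : ℕ) :
    n * multisetCount a n =
      ∑ m ∈ Finset.Icc 1 n, (∑ j ∈ m.divisors, j * a j) * multisetCount a (n - m) := by
  classical
  set T := (multisetsOfSize_finite a n).toFinset with hT
  set C := (components_finite a n).toFinset with hC
  have hTm : ∀ m ∈ T, totalSize m = n := fun m hm => by simpa [hT, multisetsOfSize] using hm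
  -- The total size is the sum of size times multiplicity, and a multiplicity is the number of `k ≥
  -- 1` not exceeding it. Summing over all multisets and exchanging sums then counts those with
  -- multiplicity at least `k`.
  have h1 : ∀ m ∈ T, n = ∑ c ∈ C, ∑ k ∈ Finset.Icc 1 n,
      if k ≤ m.count c then c.size else 0 := by
    intro m hm
    have hsub : m.toFinset ⊆ C := by
      intro c hc
      have := size_le_totalSize (Multiset.mem_toFinset.1 hc)
      rw [hTm m hm] at this
      simpa [hC] using this
    conv_lhs => rw [← hTm m hm, totalSize, Finset.sum_multiset_map_count]
    rw [Finset.sum_subset hsub]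
    · refine Finset.sum_congr rfl fun c _ => ?_
      rw [← Finset.sum_filter, Finset.sum_const]
      congr 1
      have hcn : m.count c ≤ n :=
        (Multiset.count_le_card c m).trans ((card_le_totalSize m).trans (hTm m hm).le)
      have : (Finset.Icc 1 n).filter (fun k => k ≤ m.count c) = Finset.Icc 1 (m.count c) := by
        ext k
        simp only [Finset.mem_filter, Finset.mem_Icc]
        omega
      rw [this, Nat.card_Icc, Nat.add_sub_cancel]
    · intro c _ hc
      rw [Multiset.count_eq_zero_of_notMem (fun h => hc (Multiset.mem_toFinset.2 h)), zero_smul]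
  calc n * multisetCount a n = ∑ m ∈ T, n := by
        rw [Finset.sum_const, smul_eq_mul, multisetCount_eq_card, mul_comm]
    _ = ∑ m ∈ T, ∑ c ∈ C, ∑ k ∈ Finset.Icc 1 n, (if k ≤ m.count c then c.size else 0) :=
        Finset.sum_congr rfl h1
    _ = ∑ c ∈ C, ∑ k ∈ Finset.Icc 1 n,
          c.size * (if k * c.size ≤ n then multisetCount a (n - k * c.size) else 0) := by
        rw [Finset.sum_comm]
        refine Finset.sum_congr rfl fun c _ => ?_
        rw [Finset.sum_comm]
        refine Finset.sum_congr rfl fun k _ => ?_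
        rw [← card_multisets_count_ge, ← Finset.sum_filter, Finset.sum_const, smul_eq_mul,
          mul_comm]
    _ = ∑ j ∈ Finset.Icc 1 n, a j * ∑ k ∈ Finset.Icc 1 n,
          j * (if k * j ≤ n then multisetCount a (n - k * j) else 0) :=
        sum_components a n (fun j => ∑ k ∈ Finset.Icc 1 n,
          j * (if k * j ≤ n then multisetCount a (n - k * j) else 0))
    _ = ∑ j ∈ Finset.Icc 1 n, ∑ k ∈ Finset.Icc 1 n,
          (if k * j ≤ n then j * a j * multisetCount a (n - k * j) else 0) := by
        refine Finset.sum_congr rfl fun j _ => ?_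
        rw [Finset.mul_sum]
        refine Finset.sum_congr rfl fun k _ => ?_
        split_ifs
        · ring
        · simp
    _ = _ := by
        rw [sum_Icc_multiples n (fun j m => j * a j * multisetCount a (n - m))]
        exact Finset.sum_congr rfl fun m _ => (Finset.sum_mul _ _ _).symm

/-! ### Coefficients of the logarithm, rescaled by `y ^ n`. -/

/-- Any exponent strictly between 1 and 2 would serve: above 1 it absorbs the power of `j`, and
below 2 it keeps the terms with `j ≤ m / 2` exponentially smaller than `y ^ m`. -/
theorem component_count_le {a : ℕ → ℕ} {K r y ν : ℝ} (hy : 1 < y) (hν1 : ν < 1)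
    (ha : (fun j : ℕ => (a j : ℝ) - K * (j : ℝ) ^ (r - 1) * y ^ j)
      =O[atTop] fun j : ℕ => y ^ (ν * (j : ℝ))) :
    ∃ M : ℝ, 0 < M ∧ ∀ j : ℕ, (a j : ℝ) ≤ M * y ^ ((3 / 2 : ℝ) * j) := by
  have hy0 : 0 < y := by linarith
  have hlog : 0 < Real.log y := Real.log_pos hy
  have h1 : (fun j : ℕ => y ^ (ν * (j : ℝ))) =O[atTop] fun j : ℕ => y ^ ((3 / 2 : ℝ) * j) := by
    refine IsBigO.of_norm_le fun j => ?_
    rw [Real.norm_of_nonneg (by positivity)]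
    refine Real.rpow_le_rpow_of_exponent_le hy.le ?_
    have : (0 : ℝ) ≤ j := Nat.cast_nonneg j
    nlinarith
  have h2 : (fun j : ℕ => K * (j : ℝ) ^ (r - 1) * y ^ j) =O[atTop]
      fun j : ℕ => y ^ ((3 / 2 : ℝ) * j) := by
    have h3 := (isLittleO_rpow_exp_pos_mul_atTop (r - 1)
      (show 0 < Real.log y / 2 by linarith)).isBigO.comp_tendsto tendsto_natCast_atTop_atTop
    have h4 := (h3.const_mul_left K).mul (isBigO_refl (fun j : ℕ => y ^ j) atTop)
    refine h4.congr (fun j => rfl) (fun j => ?_)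
    simp only [Function.comp]
    rw [Real.rpow_def_of_pos hy0, ← Real.rpow_natCast, Real.rpow_def_of_pos hy0, ← Real.exp_add]
    congr 1
    ring
  have h5 : (fun j : ℕ => (a j : ℝ)) =O[atTop] fun j : ℕ => y ^ ((3 / 2 : ℝ) * j) :=
    ((ha.trans h1).add h2).congr_left fun j => by ring
  obtain ⟨C, hC, hb⟩ := bound_of_isBigO_nat_atTop h5
  refine ⟨C, hC, fun j => ?_⟩
  have := hb (x := j) (by positivity)
  rwa [Real.norm_of_nonneg (by positivity), Real.norm_of_nonneg (by positivity)] at this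

/-- The coefficients of the logarithm of the rescaled generating function differ from
`K m ^ (r - 1)` by a summable sequence. -/
theorem summable_log_coeff_sub {a : ℕ → ℕ} {K r y ν : ℝ} (hy : 1 < y) (hν1 : ν < 1)
    (ha : (fun j : ℕ => (a j : ℝ) - K * (j : ℝ) ^ (r - 1) * y ^ j)
      =O[atTop] fun j : ℕ => y ^ (ν * (j : ℝ))) :
    Summable fun m : ℕ =>
      ((∑ j ∈ m.divisors, j * a j : ℕ) : ℝ) / (m * y ^ m) - K * (m : ℝ) ^ (r - 1) := by
  have hy0 : 0 < y := by linarith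
  obtain ⟨M, hM, hab⟩ := component_count_le hy hν1 ha
  have hq : ‖y ^ (ν - 1)‖ < 1 := by
    rw [Real.norm_of_nonneg (by positivity)]
    exact Real.rpow_lt_one_of_one_lt_of_neg hy (by linarith)
  have hq' : ‖y ^ (-(1 / 4) : ℝ)‖ < 1 := by
    rw [Real.norm_of_nonneg (by positivity)]
    exact Real.rpow_lt_one_of_one_lt_of_neg hy (by norm_num)
  have hs1 : Summable fun m : ℕ => (a m : ℝ) / y ^ m - K * (m : ℝ) ^ (r - 1) := by
    refine summable_of_isBigO_nat (summable_geometric_of_norm_lt_one hq) ?_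
    have h1 := ha.mul (isBigO_refl (fun j : ℕ => (y ^ j)⁻¹) atTop)
    refine h1.congr (fun j => ?_) (fun j => ?_)
    · field_simp
    · rw [← Real.rpow_natCast, ← Real.rpow_natCast, ← Real.rpow_neg hy0.le,
        ← Real.rpow_add hy0, ← Real.rpow_mul hy0.le]
      congr 1
      ring
  have hs2 : Summable fun m : ℕ =>
      ((∑ j ∈ m.properDivisors, j * a j : ℕ) : ℝ) / (m * y ^ m) := by
    refine Summable.of_nonneg_of_le (fun m => by positivity) (fun m => ?_)
      ((summable_pow_mul_geometric_of_norm_lt_one 1 hq').mul_left M)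
    rcases Nat.eq_zero_or_pos m with rfl | hm
    · simp
    have hm' : (0 : ℝ) < m := by exact_mod_cast hm
    rw [div_le_iff₀ (by positivity)]
    push_cast
    have hterm : ∀ j ∈ m.properDivisors, (j : ℝ) * a j ≤ m * (M * y ^ ((3 / 4 : ℝ) * m)) := by
      intro j hj
      rw [Nat.mem_properDivisors] at hj
      have hj2 : 2 * j ≤ m := by
        obtain ⟨k, rfl⟩ := hj.1
        have : 2 ≤ k := by
          by_contra hk
          interval_cases k <;> omega
        nlinarith
      have hj2' : 2 * (j : ℝ) ≤ m := by exact_mod_cast hj2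
      have hj0 : (0 : ℝ) ≤ j := Nat.cast_nonneg j
      refine mul_le_mul (by linarith) ((hab j).trans ?_) (by positivity) hm'.le
      refine mul_le_mul_of_nonneg_left ?_ hM.le
      exact Real.rpow_le_rpow_of_exponent_le hy.le (by linarith)
    have hcard : (m.properDivisors.card : ℝ) ≤ m := by
      have : m.properDivisors.card ≤ (Finset.Ico 1 m).card := Finset.card_filter_le _ _
      rw [Nat.card_Ico] at this
      exact_mod_cast this.trans (Nat.sub_le _ _)
    calc ∑ j ∈ m.properDivisors, (j : ℝ) * a j
        ≤ m.properDivisors.card • ((m : ℝ) * (M * y ^ ((3 / 4 : ℝ) * m))) :=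
          Finset.sum_le_card_nsmul _ _ _ hterm
      _ ≤ m * ((m : ℝ) * (M * y ^ ((3 / 4 : ℝ) * m))) := by
          rw [nsmul_eq_mul]
          gcongr
      _ = M * ((m : ℝ) ^ 1 * (y ^ (-(1 / 4) : ℝ)) ^ m) * (m * y ^ m) := by
          have : y ^ ((3 / 4 : ℝ) * m) = (y ^ (-(1 / 4) : ℝ)) ^ m * y ^ m := by
            rw [← Real.rpow_natCast, ← Real.rpow_natCast, ← Real.rpow_mul hy0.le,
              ← Real.rpow_add hy0]
            congr 1
            ring
          rw [this]
          ring
  -- The divisor `m` can be split off from the proper ones only for `m ≠ 0`, so the index is shifted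
  -- by one.
  refine (summable_nat_add_iff 1).1 ?_
  refine ((summable_nat_add_iff 1).2 (hs1.add hs2)).congr fun m => ?_
  rw [← Nat.cons_self_properDivisors (Nat.succ_ne_zero m), Finset.sum_cons]
  have : ((m + 1 : ℕ) : ℝ) ≠ 0 := by positivity
  push_cast at this ⊢
  field_simp
  ring

theorem rescaled_recurrence (a : ℕ → ℕ) {y : ℝ} (hy : 0 < y) (n : ℕ) :
    (n : ℝ) * (multisetCount a n / y ^ n) = ∑ m ∈ Finset.Icc 1 n,
      m * (((∑ j ∈ m.divisors, j * a j : ℕ) : ℝ) / (m * y ^ m)) *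
        (multisetCount a (n - m) / y ^ (n - m)) := by
  rw [← mul_div_assoc, ← Nat.cast_mul, mul_multisetCount, Nat.cast_sum, Finset.sum_div]
  refine Finset.sum_congr rfl fun m hm => ?_
  rw [Finset.mem_Icc] at hm
  have : (m : ℝ) ≠ 0 := by
    have := hm.1
    positivity
  have h2 : y ^ n = y ^ m * y ^ (n - m) := by rw [← pow_add, Nat.add_sub_cancel' hm.2]
  rw [h2, Nat.cast_mul]
  field_simp

/-! ### From the recurrence to a Cauchy integral. -/

theorem hasFPowerSeriesOnBall_tsum {c : ℕ → ℂ}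
    (hc : ∀ ρ : ℝ, 0 ≤ ρ → ρ < 1 → Summable fun m => ‖c m‖ * ρ ^ m) :
    HasFPowerSeriesOnBall (fun z => ∑' m, c m * z ^ m)
      (FormalMultilinearSeries.ofScalars ℂ c) 0 1 := by
  have hrad : 1 ≤ (FormalMultilinearSeries.ofScalars ℂ c).radius := by
    refine ENNReal.le_of_forall_nnreal_lt fun ρ hρ => ?_
    refine FormalMultilinearSeries.le_radius_of_summable _ ?_
    simp_rw [FormalMultilinearSeries.ofScalars_norm]
    exact hc ρ ρ.2 (by exact_mod_cast hρ)
  have h := ((FormalMultilinearSeries.ofScalars ℂ c).hasFPowerSeriesOnBall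
    (lt_of_lt_of_le one_pos hrad)).mono one_pos hrad
  refine h.congr fun z _ => ?_
  change FormalMultilinearSeries.ofScalarsSum c z = _
  rw [FormalMultilinearSeries.ofScalars_sum_eq]
  simp [smul_eq_mul]

/-- The coefficients of the exponential of a power series are determined by the recurrence coming
from logarithmic differentiation. -/
theorem iteratedDeriv_exp_comp {L : ℂ → ℂ} {c b : ℕ → ℂ}
    (hL : HasFPowerSeriesOnBall L (FormalMultilinearSeries.ofScalars ℂ c) 0 1)
    (hc0 : c 0 = 0) (hb0 : b 0 = 1)
    (hrec : ∀ n : ℕ, (n : ℂ) * b n = ∑ m ∈ Finset.Icc 1 n, m * c m * b (n - m)) (n : ℕ) :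
    iteratedDeriv n (fun z => Complex.exp (L z)) 0 = n.factorial * b n := by
  have hLan : AnalyticAt ℂ L 0 := hL.analyticAt
  have hFan : AnalyticAt ℂ (fun z => Complex.exp (L z)) 0 := hLan.cexp
  have hLd : ∀ k, iteratedDeriv k L 0 = k.factorial * c k := by
    intro k
    have h := hL.factorial_smul 1 k
    rw [iteratedDeriv_eq_iteratedFDeriv, ← h]
    simp
  induction n using Nat.strong_induction_on with
  | _ n ih =>
  rcases n with _ | n
  · have : L 0 = 0 := by simpa [hc0] using hLd 0
    simp [this, hb0]
  -- Leibniz' rule applied to `F' = L' F` gives the assumed recurrence, once the binomial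
  -- coefficients are absorbed into the factorials.
  have hev : deriv (fun z => Complex.exp (L z)) =ᶠ[nhds 0]
      (fun z => deriv L z * Complex.exp (L z)) := by
    filter_upwards [hLan.eventually_analyticAt] with z hz
    rw [deriv_cexp hz.differentiableAt, mul_comm]
  rw [iteratedDeriv_succ', hev.iteratedDeriv_eq,
    iteratedDeriv_fun_mul hLan.deriv.contDiffAt hFan.contDiffAt]
  have hn : ((n + 1 : ℕ) : ℂ) * b (n + 1) =
      ∑ i ∈ Finset.range (n + 1), (i + 1 : ℕ) * c (i + 1) * b (n - i) := by
    have h := Finset.sum_Ico_add' (fun m : ℕ => (m : ℂ) * c m * b (n + 1 - m)) 0 (n + 1) 1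
    simp only [Nat.add_sub_add_right, ← Finset.range_eq_Ico] at h
    rw [hrec, h]
    rfl
  rw [Nat.factorial_succ, Nat.cast_mul, mul_right_comm, hn, Finset.sum_mul]
  refine Finset.sum_congr rfl fun i hi => ?_
  have hi' : i ≤ n := Nat.lt_succ_iff.1 (Finset.mem_range.1 hi)
  rw [← iteratedDeriv_succ', hLd, ih (n - i) (by omega), ← Nat.choose_mul_factorial_mul_factorial hi',
    Nat.factorial_succ]
  push_cast
  ring

/-- Cauchy's formula on the circle `x = exp (-(σ - iθ))`. Periodicity in `θ` recentres the interval
at the saddle `θ = 0`. -/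
theorem two_pi_mul_coeff_eq_integral {c b : ℕ → ℂ}
    (hc : ∀ ρ : ℝ, 0 ≤ ρ → ρ < 1 → Summable fun m => ‖c m‖ * ρ ^ m)
    (hc0 : c 0 = 0) (hb0 : b 0 = 1)
    (hrec : ∀ n : ℕ, (n : ℂ) * b n = ∑ m ∈ Finset.Icc 1 n, m * c m * b (n - m))
    {σ : ℝ} (hσ : 0 < σ) (n : ℕ) :
    2 * Real.pi * b n = ∫ θ : ℝ in -Real.pi..Real.pi,
      Complex.exp ((∑' m : ℕ, c m * Complex.exp (-(m * (σ - θ * Complex.I)))) +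
        n * (σ - θ * Complex.I)) := by
  have hL := hasFPowerSeriesOnBall_tsum hc
  have hd : DifferentiableOn ℂ (fun z => Complex.exp (∑' m, c m * z ^ m))
      (Metric.closedBall 0 (Real.exp (-σ))) := by
    have h1 := hL.differentiableOn
    have h2 : Metric.closedBall (0 : ℂ) (Real.exp (-σ)) ⊆ Metric.eball 0 1 := by
      intro z hz
      rw [mem_closedBall_zero_iff] at hz
      have : ‖z‖ < 1 := hz.trans_lt (Real.exp_lt_one_iff.2 (by linarith))
      rw [Metric.mem_eball, edist_zero_right]
      rw [← ofReal_norm]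
      exact ENNReal.ofReal_lt_one.2 this
    exact (h1.mono h2).cexp
  have h := hd.circleIntegral_one_div_sub_center_pow_smul (Real.exp_pos _) n
  rw [iteratedDeriv_exp_comp hL hc0 hb0 hrec] at h
  have hfac : (n.factorial : ℂ) ≠ 0 := by exact_mod_cast n.factorial_ne_zero
  have h2 : (2 * Real.pi * Complex.I / n.factorial) • ((n.factorial : ℂ) * b n) =
      Complex.I * (2 * Real.pi * b n) := by
    rw [smul_eq_mul]
    field_simp
  rw [h2, circleIntegral] at h
  have hz : ∀ θ : ℝ, circleMap 0 (Real.exp (-σ)) θ = Complex.exp (-(σ - θ * Complex.I)) := by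
    intro θ
    rw [circleMap, zero_add, Complex.ofReal_exp, ← Complex.exp_add]
    congr 1
    push_cast
    ring
  have hint : ∀ θ : ℝ, deriv (circleMap 0 (Real.exp (-σ))) θ •
      (1 / (circleMap 0 (Real.exp (-σ)) θ - 0) ^ (n + 1)) •
        Complex.exp (∑' m, c m * circleMap 0 (Real.exp (-σ)) θ ^ m) =
      Complex.I * Complex.exp ((∑' m : ℕ, c m * Complex.exp (-(m * (σ - θ * Complex.I)))) +
        n * (σ - θ * Complex.I)) := by
    intro θ
    have hne : Complex.exp (-(σ - θ * Complex.I)) ≠ 0 := Complex.exp_ne_zero _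
    have h3 : Complex.exp (n * (σ - θ * Complex.I)) =
        (Complex.exp (-(σ - θ * Complex.I)) ^ n)⁻¹ := by
      rw [← Complex.exp_nat_mul, ← Complex.exp_neg]
      congr 1
      ring
    have h4 : ∀ m : ℕ, Complex.exp (-(m * (σ - θ * Complex.I))) =
        Complex.exp (-(σ - θ * Complex.I)) ^ m := by
      intro m
      rw [← Complex.exp_nat_mul]
      congr 1
      ring
    rw [deriv_circleMap, hz, Complex.exp_add, h3]
    simp_rw [h4, smul_eq_mul]
    field_simp
    simp only [sub_zero, pow_succ]
    ring
  simp_rw [hint] at h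
  rw [intervalIntegral.integral_const_mul] at h
  have h5 := mul_left_cancel₀ Complex.I_ne_zero h
  rw [← h5]
  have hper : Function.Periodic (fun θ : ℝ =>
      Complex.exp ((∑' m : ℕ, c m * Complex.exp (-(m * (σ - θ * Complex.I)))) +
        n * (σ - θ * Complex.I))) (2 * Real.pi) := by
    intro θ
    have h6 : ∀ m : ℕ, Complex.exp (-(m * (σ - ((θ + 2 * Real.pi : ℝ) : ℂ) * Complex.I))) =
        Complex.exp (-(m * (σ - θ * Complex.I))) := by
      intro m
      rw [Complex.exp_eq_exp_iff_exists_int]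
      exact ⟨m, by push_cast; ring⟩
    simp_rw [h6]
    rw [Complex.exp_eq_exp_iff_exists_int]
    exact ⟨-n, by push_cast; ring⟩
  have h7 := hper.intervalIntegral_add_eq 0 (-Real.pi)
  rw [zero_add, show -Real.pi + 2 * Real.pi = Real.pi by ring] at h7
  exact h7

/-! ### The Laplace transform of a power in the right half-plane. -/

theorem integrableOn_rpow_mul_exp_neg_Ioi {q σ : ℝ} (hq : -1 < q) (hσ : 0 < σ) :
    MeasureTheory.IntegrableOn (fun x : ℝ => x ^ q * Real.exp (-(σ * x))) (Set.Ioi 0) := by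
  refine (integrableOn_rpow_mul_exp_neg_mul_rpow hq one_pos hσ).congr_fun (fun x _ => ?_)
    measurableSet_Ioi
  simp [Real.rpow_one]

theorem norm_rpow_mul_cexp (q x : ℝ) (hx : 0 ≤ x) (s : ℂ) :
    ‖((x ^ q : ℝ) : ℂ) * Complex.exp (-(s * x))‖ = x ^ q * Real.exp (-(s.re * x)) := by
  rw [norm_mul, Complex.norm_real, Real.norm_of_nonneg (Real.rpow_nonneg hx _), Complex.norm_exp]
  simp

theorem measurable_rpow_mul_cexp (q : ℝ) (s : ℂ) :
    Measurable fun x : ℝ => ((x ^ q : ℝ) : ℂ) * Complex.exp (-(s * x)) := by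
  fun_prop

theorem hasDerivAt_laplace_rpow {q : ℝ} (hq : -1 < q) {s : ℂ} (hs : 0 < s.re) :
    HasDerivAt (fun s : ℂ => ∫ x in Set.Ioi (0 : ℝ), ((x ^ q : ℝ) : ℂ) * Complex.exp (-(s * x)))
      (∫ x in Set.Ioi (0 : ℝ), ((x ^ q : ℝ) : ℂ) * (Complex.exp (-(s * x)) * (-x))) s := by
  have hmem : {z : ℂ | s.re / 2 < z.re} ∈ nhds s :=
    (isOpen_lt continuous_const Complex.continuous_re).mem_nhds
      (show s.re / 2 < s.re by linarith)
  refine (hasDerivAt_integral_of_dominated_loc_of_deriv_le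
    (bound := fun x : ℝ => x ^ (q + 1) * Real.exp (-(s.re / 2 * x)))
    (F' := fun z x => ((x ^ q : ℝ) : ℂ) * (Complex.exp (-(z * x)) * (-x))) hmem
    (Eventually.of_forall fun z => (measurable_rpow_mul_cexp q z).aestronglyMeasurable)
    ?_ (Measurable.aestronglyMeasurable (by fun_prop)) ?_ (integrableOn_rpow_mul_exp_neg_Ioi (by linarith) (by linarith)) ?_).2
  · refine MeasureTheory.Integrable.mono' (integrableOn_rpow_mul_exp_neg_Ioi hq hs)
      (measurable_rpow_mul_cexp q s).aestronglyMeasurable ?_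
    filter_upwards [MeasureTheory.ae_restrict_mem measurableSet_Ioi] with x hx
    exact (norm_rpow_mul_cexp q x (le_of_lt hx) s).le
  · filter_upwards [MeasureTheory.ae_restrict_mem measurableSet_Ioi] with x hx z hz
    have hx' : (0 : ℝ) < x := hx
    rw [← mul_assoc, norm_mul, norm_rpow_mul_cexp q x hx'.le z, norm_neg, Complex.norm_real,
      Real.norm_of_nonneg hx'.le, Real.rpow_add_one hx'.ne', mul_right_comm]
    refine mul_le_mul_of_nonneg_left (Real.exp_le_exp.2 ?_) (by positivity)
    have : s.re / 2 < z.re := hz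
    nlinarith
  · refine Eventually.of_forall fun x z _ => ?_
    have h : HasDerivAt (fun z : ℂ => -(z * x)) (-(x : ℂ)) z := by
      simpa using! ((hasDerivAt_id z).mul_const (x : ℂ)).neg
    exact (h.cexp).const_mul _

/-- The Laplace transform of `x ^ q`, on the right half-plane. -/
theorem integral_rpow_mul_cexp_neg_Ioi {q : ℝ} (hq : -1 < q) {s : ℂ} (hs : 0 < s.re) :
    ∫ x in Set.Ioi (0 : ℝ), ((x ^ q : ℝ) : ℂ) * Complex.exp (-(s * x)) =
      Real.Gamma (q + 1) * s ^ (-((q + 1 : ℝ) : ℂ)) := by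
  have hopen : IsOpen {z : ℂ | 0 < z.re} := isOpen_lt continuous_const Complex.continuous_re
  have h1 : AnalyticOnNhd ℂ (fun s : ℂ => ∫ x in Set.Ioi (0 : ℝ),
      ((x ^ q : ℝ) : ℂ) * Complex.exp (-(s * x))) {z : ℂ | 0 < z.re} :=
    DifferentiableOn.analyticOnNhd (fun z hz =>
      (hasDerivAt_laplace_rpow hq hz).differentiableAt.differentiableWithinAt) hopen
  have h2 : AnalyticOnNhd ℂ (fun s : ℂ => Real.Gamma (q + 1) * s ^ (-((q + 1 : ℝ) : ℂ)))
      {z : ℂ | 0 < z.re} :=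
    DifferentiableOn.analyticOnNhd (fun z hz =>
      ((((hasDerivAt_id z).cpow_const (Or.inl hz)).const_mul
        _).differentiableAt.differentiableWithinAt)) hopen
  have hpre : IsPreconnected {z : ℂ | 0 < z.re} := (convex_halfSpace_re_gt 0).isPreconnected
  have hreal : ∀ t : ℝ, 0 < t → ∫ x in Set.Ioi (0 : ℝ),
      ((x ^ q : ℝ) : ℂ) * Complex.exp (-((t : ℂ) * x)) =
      Real.Gamma (q + 1) * (t : ℂ) ^ (-((q + 1 : ℝ) : ℂ)) := by
    intro t ht
    have h3 := Real.integral_rpow_mul_exp_neg_mul_Ioi (show 0 < q + 1 by linarith) ht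
    rw [← Complex.ofReal_neg, ← Complex.ofReal_cpow ht.le, ← Complex.ofReal_mul,
      Real.rpow_neg ht.le, ← Real.inv_rpow ht.le, mul_comm, ← one_div, ← h3]
    rw [← integral_complex_ofReal]
    simp
  -- Identity theorem: both sides are analytic and agree on the positive reals, which accumulate at
  -- `1`.
  refine h1.eqOn_of_preconnected_of_frequently_eq h2 hpre (z₀ := 1) (by simp) ?_ hs
  have htend : Tendsto (fun t : ℝ => (t : ℂ)) (nhdsWithin 1 {1}ᶜ) (nhdsWithin 1 {1}ᶜ) := by
    refine tendsto_nhdsWithin_of_tendsto_nhds_of_eventually_within _ ?_ ?_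
    · exact (Complex.continuous_ofReal.tendsto' 1 1 (by simp)).mono_left nhdsWithin_le_nhds
    · filter_upwards [self_mem_nhdsWithin] with t ht
      simpa using ht
  refine htend.frequently (Eventually.frequently ?_)
  filter_upwards [nhdsWithin_le_nhds (lt_mem_nhds (zero_lt_one' ℝ))] with t ht
  exact hreal t ht

/-! ### Poisson summation for `∑ m ^ q exp (-m s)`. -/

theorem summable_rpow_mul_exp_neg (q : ℝ) {σ : ℝ} (hσ : 0 < σ) :
    Summable fun m : ℕ => ((m + 1 : ℕ) : ℝ) ^ q * Real.exp (-(((m + 1 : ℕ) : ℝ) * σ)) := by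
  obtain ⟨k, hk⟩ := exists_nat_ge q
  refine Summable.of_nonneg_of_le (fun m => by positivity) (fun m => ?_)
    ((summable_nat_add_iff 1).2 (Real.summable_pow_mul_exp_neg_nat_mul k hσ))
  rw [← Real.rpow_natCast]
  have : (1 : ℝ) ≤ ((m + 1 : ℕ) : ℝ) := by exact_mod_cast Nat.le_add_left 1 m
  refine mul_le_mul (Real.rpow_le_rpow_of_exponent_le this hk) (Real.exp_le_exp.2 ?_)
    (by positivity) (by positivity)
  exact le_of_eq (by ring)

/-- `x ^ q * exp (-s x)` on the positive half-line, extended by zero. -/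
noncomputable def truncatedGammaKernel (q : ℝ) (s : ℂ) (x : ℝ) : ℂ :=
  ((max x 0 ^ q : ℝ) : ℂ) * Complex.exp (-(s * x))

theorem truncatedGammaKernel_of_nonpos {q : ℝ} (hq : 0 < q) (s : ℂ) {x : ℝ} (hx : x ≤ 0) :
    truncatedGammaKernel q s x = 0 := by
  simp [truncatedGammaKernel, max_eq_right hx, Real.zero_rpow hq.ne']

theorem truncatedGammaKernel_of_nonneg (q : ℝ) (s : ℂ) {x : ℝ} (hx : 0 ≤ x) :
    truncatedGammaKernel q s x = ((x ^ q : ℝ) : ℂ) * Complex.exp (-(s * x)) := by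
  simp [truncatedGammaKernel, max_eq_left hx]

/-- The condition `q > 0` makes the kernel vanish at the cut, giving the continuity that Poisson
summation needs. -/
theorem continuous_truncatedGammaKernel {q : ℝ} (hq : 0 < q) (s : ℂ) :
    Continuous (truncatedGammaKernel q s) := by
  have h : Continuous fun x : ℝ => max x 0 ^ q :=
    (continuous_id.max continuous_const).rpow_const fun x => Or.inr hq.le
  unfold truncatedGammaKernel
  fun_prop

theorem truncatedGammaKernel_isBigO {q : ℝ} (hq : 0 < q) {s : ℂ} (hs : 0 < s.re) (b : ℝ) :
    truncatedGammaKernel q s =O[cocompact ℝ] fun x : ℝ => |x| ^ (-b) := by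
  rw [cocompact_eq_atBot_atTop, isBigO_sup]
  constructor
  · refine IsBigO.of_bound 0 ?_
    filter_upwards [eventually_le_atBot 0] with x hx
    simp [truncatedGammaKernel_of_nonpos hq s hx]
  · have h := isLittleO_exp_neg_mul_rpow_atTop hs (-b - q)
    refine IsBigO.of_bound 1 ?_
    filter_upwards [h.bound one_pos, eventually_gt_atTop 0] with x hx hx0
    rw [truncatedGammaKernel_of_nonneg q s hx0.le, norm_rpow_mul_cexp q x hx0.le,
      Real.norm_of_nonneg (by positivity), abs_of_pos hx0]
    rw [Real.norm_of_nonneg (by positivity), Real.norm_of_nonneg (by positivity)] at hx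
    calc x ^ q * Real.exp (-(s.re * x)) ≤ x ^ q * (1 * x ^ (-b - q)) := by
          refine mul_le_mul_of_nonneg_left ?_ (by positivity)
          rwa [← neg_mul]
      _ = 1 * x ^ (-b) := by
          rw [mul_left_comm, ← Real.rpow_add hx0]
          congr 2
          ring

open FourierTransform in
theorem fourier_truncatedGammaKernel {q : ℝ} (hq : 0 < q) {s : ℂ} (hs : 0 < s.re) (ξ : ℝ) :
    𝓕 (truncatedGammaKernel q s) ξ = Real.Gamma (q + 1) *
      (s + 2 * Real.pi * ξ * Complex.I) ^ (-((q + 1 : ℝ) : ℂ)) := by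
  have hs' : 0 < (s + 2 * Real.pi * ξ * Complex.I).re := by simpa using hs
  rw [← integral_rpow_mul_cexp_neg_Ioi (by linarith) hs', Real.fourier_real_eq_integral_exp_smul,
    ← MeasureTheory.integral_indicator measurableSet_Ioi]
  congr 1
  ext x
  rcases le_or_gt x 0 with hx | hx
  · rw [truncatedGammaKernel_of_nonpos hq s hx, smul_zero,
      Set.indicator_of_notMem (by simpa using hx)]
  · rw [truncatedGammaKernel_of_nonneg q s hx.le, Set.indicator_of_mem (by simpa using hx),
      smul_eq_mul, mul_left_comm, ← Complex.exp_add]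
    congr 2
    push_cast
    ring

theorem norm_add_cpow_neg_le {p : ℝ} (hp : 0 < p) {s : ℂ} (hs : 0 < s.re) (him : |s.im| ≤ Real.pi)
    {k : ℤ} (hk : k ≠ 0) :
    ‖(s + 2 * Real.pi * (k : ℝ) * Complex.I) ^ (-(p : ℂ))‖ ≤
      Real.pi ^ (-p) * |(k : ℝ)| ^ (-p) := by
  have hpi := Real.pi_pos
  have hs' : 0 < (s + 2 * Real.pi * (k : ℝ) * Complex.I).re := by simpa using hs
  have hne : s + 2 * Real.pi * (k : ℝ) * Complex.I ≠ 0 := by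
    intro h
    rw [h] at hs'
    simp at hs'
  have hk1 : 1 ≤ |(k : ℝ)| := by exact_mod_cast Int.one_le_abs hk
  have hnorm : Real.pi * |(k : ℝ)| ≤ ‖s + 2 * Real.pi * (k : ℝ) * Complex.I‖ := by
    refine le_trans ?_ (Complex.abs_im_le_norm _)
    have h1 : (s + 2 * Real.pi * (k : ℝ) * Complex.I).im = 2 * Real.pi * k + s.im := by
      simp [add_comm]
    rw [h1]
    have h2 : |2 * Real.pi * (k : ℝ)| = 2 * Real.pi * |(k : ℝ)| := by
      rw [abs_mul, abs_of_pos (by positivity : 0 < 2 * Real.pi)]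
    have h3 := abs_sub_abs_le_abs_sub (2 * Real.pi * (k : ℝ)) (-s.im)
    rw [abs_neg, sub_neg_eq_add] at h3
    nlinarith
  rw [← Real.mul_rpow hpi.le (abs_nonneg _), ← Complex.ofReal_neg,
    Complex.norm_cpow_real]
  exact Real.rpow_le_rpow_of_nonpos (by positivity) hnorm (by linarith)

/-- `∑ m ^ q exp (-m s)`, summed over the positive integers `m`. -/
noncomputable def polylogSeries (q : ℝ) (s : ℂ) : ℂ :=
  ∑' m : ℕ, ((((m + 1 : ℕ) : ℝ) ^ q : ℝ) : ℂ) * Complex.exp (-(((m + 1 : ℕ) : ℂ) * s))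

/-- In the Poisson formula the zero frequency is the main term. At frequency `k ≠ 0`, `|im s| ≤ π`
forces `|s + 2πik| ≥ π|k|`, so the rest is dominated by `∑ |k| ^ (-(q + 1))` independently of `s`.
-/
theorem exists_norm_polylogSeries_sub_le {q : ℝ} (hq : 0 < q) :
    ∃ C : ℝ, ∀ s : ℂ, 0 < s.re → |s.im| ≤ Real.pi →
      ‖polylogSeries q s - Real.Gamma (q + 1) * s ^ (-((q + 1 : ℝ) : ℂ))‖ ≤ C := by
  have hq1 : 1 < q + 1 := by linarith
  have hsumk : Summable fun k : ℤ => |(k : ℝ)| ^ (-(q + 1)) := Real.summable_abs_int_rpow hq1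
  have hG : 0 < Real.Gamma (q + 1) := Real.Gamma_pos_of_pos (by linarith)
  refine ⟨∑' k : ℤ, Real.Gamma (q + 1) * (Real.pi ^ (-(q + 1)) * |(k : ℝ)| ^ (-(q + 1))),
    fun s hs him => ?_⟩
  have hsum2 : Summable fun k : ℤ =>
      Real.Gamma (q + 1) * (Real.pi ^ (-(q + 1)) * |(k : ℝ)| ^ (-(q + 1))) :=
    (hsumk.mul_left _).mul_left _
  have hbound : ∀ k : ℤ, k ≠ 0 → ‖FourierTransform.fourier (truncatedGammaKernel q s) (k : ℝ)‖ ≤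
      Real.Gamma (q + 1) * (Real.pi ^ (-(q + 1)) * |(k : ℝ)| ^ (-(q + 1))) := by
    intro k hk
    rw [fourier_truncatedGammaKernel hq hs, norm_mul, Complex.norm_real,
      Real.norm_of_nonneg hG.le]
    exact mul_le_mul_of_nonneg_left
      (norm_add_cpow_neg_le (by linarith) hs him hk) hG.le
  have hsumF : Summable fun k : ℤ =>
      FourierTransform.fourier (truncatedGammaKernel q s) (k : ℝ) := by
    refine Summable.of_norm_bounded_eventually hsum2 ?_
    filter_upwards [(Set.finite_singleton (0 : ℤ)).compl_mem_cofinite] with k hk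
    exact hbound k hk
  have hP := Real.tsum_eq_tsum_fourier_of_rpow_decay_of_summable
    (continuous_truncatedGammaKernel hq s) hq1 (truncatedGammaKernel_isBigO hq hs (q + 1)) hsumF 0
  have hleft : ∑' n : ℤ, truncatedGammaKernel q s (0 + n) = polylogSeries q s := by
    have hinj : Function.Injective fun m : ℕ => ((m + 1 : ℕ) : ℤ) := by
      intro m m' h
      simpa using h
    rw [← hinj.tsum_eq]
    · refine tsum_congr fun m => ?_
      have : (0 : ℝ) ≤ 0 + (((m + 1 : ℕ) : ℤ) : ℝ) := by
        rw [zero_add]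
        positivity
      rw [truncatedGammaKernel_of_nonneg q s this]
      simp only [zero_add, Int.cast_natCast, Complex.ofReal_natCast]
      rw [mul_comm s]
    · intro n hn
      rcases le_or_gt n 0 with h | h
      · refine absurd (truncatedGammaKernel_of_nonpos hq s ?_) hn
        rw [zero_add]
        exact_mod_cast h
      · exact ⟨(n - 1).toNat, by simp only []; omega⟩
  simp only [QuotientAddGroup.mk_zero, fourier_eval_zero, mul_one] at hP
  rw [hleft, hsumF.tsum_eq_add_tsum_ite 0] at hP
  rw [hP, fourier_truncatedGammaKernel hq hs]
  simp only [Int.cast_zero, Complex.ofReal_zero, mul_zero, zero_mul, add_zero, add_sub_cancel_left]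
  refine tsum_of_norm_bounded hsum2.hasSum fun k => ?_
  split_ifs with hk
  · rw [norm_zero]
    positivity
  · exact hbound k hk

/-! ### Expansion of the series at the origin. -/

theorem norm_polylog_term (q : ℝ) (s : ℂ) (m : ℕ) :
    ‖((((m + 1 : ℕ) : ℝ) ^ q : ℝ) : ℂ) * Complex.exp (-(((m + 1 : ℕ) : ℂ) * s))‖ =
      ((m + 1 : ℕ) : ℝ) ^ q * Real.exp (-(((m + 1 : ℕ) : ℝ) * s.re)) := by
  rw [norm_mul, Complex.norm_real, Real.norm_of_nonneg (by positivity), Complex.norm_exp]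
  congr 2
  rw [Complex.neg_re, ← Complex.ofReal_natCast, Complex.re_ofReal_mul]

theorem summable_polylogSeries (q : ℝ) {s : ℂ} (hs : 0 < s.re) :
    Summable fun m : ℕ =>
      ((((m + 1 : ℕ) : ℝ) ^ q : ℝ) : ℂ) * Complex.exp (-(((m + 1 : ℕ) : ℂ) * s)) := by
  refine Summable.of_norm ?_
  simp_rw [norm_polylog_term]
  exact summable_rpow_mul_exp_neg q hs

theorem hasDerivAt_polylogSeries (q : ℝ) {s : ℂ} (hs : 0 < s.re) :
    HasDerivAt (polylogSeries q) (-polylogSeries (q + 1) s) s := by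
  have hopen : IsOpen {z : ℂ | s.re / 2 < z.re} :=
    isOpen_lt continuous_const Complex.continuous_re
  have hpre : IsPreconnected {z : ℂ | s.re / 2 < z.re} :=
    (convex_halfSpace_re_gt _).isPreconnected
  have hmem : s ∈ {z : ℂ | s.re / 2 < z.re} := show s.re / 2 < s.re by linarith
  have h := hasDerivAt_tsum_of_isPreconnected
    (g := fun (m : ℕ) (z : ℂ) =>
      ((((m + 1 : ℕ) : ℝ) ^ q : ℝ) : ℂ) * Complex.exp (-(((m + 1 : ℕ) : ℂ) * z)))
    (g' := fun (m : ℕ) (z : ℂ) =>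
      -(((((m + 1 : ℕ) : ℝ) ^ (q + 1) : ℝ) : ℂ) * Complex.exp (-(((m + 1 : ℕ) : ℂ) * z))))
    (summable_rpow_mul_exp_neg (q + 1) (show 0 < s.re / 2 by linarith)) hopen hpre ?_ ?_ hmem
    (summable_polylogSeries q hs) hmem
  · rw [tsum_neg] at h
    exact h
  · intro m z _
    have h1 : HasDerivAt (fun z : ℂ => -(((m + 1 : ℕ) : ℂ) * z)) (-((m + 1 : ℕ) : ℂ)) z := by
      simpa using! ((hasDerivAt_id z).const_mul ((m + 1 : ℕ) : ℂ)).neg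
    refine (h1.cexp.const_mul _).congr_deriv ?_
    rw [Real.rpow_add_one (by positivity), Complex.ofReal_mul, Complex.ofReal_natCast]
    ring
  · intro m z hz
    rw [norm_neg, norm_polylog_term]
    have hz' : s.re / 2 < z.re := hz
    gcongr

theorem polylogSeries_ofReal (q σ : ℝ) : ∃ x : ℝ, polylogSeries q σ = x :=
  ⟨∑' m : ℕ, ((m + 1 : ℕ) : ℝ) ^ q * Real.exp (-(((m + 1 : ℕ) : ℝ) * σ)), by
    rw [Complex.ofReal_tsum, polylogSeries]
    push_cast
    rfl⟩

/-- Near the origin, `∑ m ^ (r - 1) exp (-m s)` is `Γ(r) s ^ (-r)` plus a constant plus `O(s)`. -/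
theorem exists_polylogSeries_expansion {r : ℝ} (hr : 0 < r) :
    ∃ E C : ℝ, 0 ≤ C ∧ ∀ s : ℂ, 0 < s.re → |s.im| ≤ Real.pi →
      ‖polylogSeries (r - 1) s - Real.Gamma r * s ^ (-(r : ℂ)) - E‖ ≤ C * ‖s‖ := by
  obtain ⟨C, hC⟩ := exists_norm_polylogSeries_sub_le hr
  set S : Set ℂ := {s | 0 < s.re} ∩ ({s | s.im ≤ Real.pi} ∩ {s | -Real.pi ≤ s.im}) with hS
  have hSm : ∀ s, s ∈ S ↔ 0 < s.re ∧ |s.im| ≤ Real.pi := by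
    intro s
    rw [abs_le, and_comm (a := -Real.pi ≤ s.im)]
    rfl
  have hconv : Convex ℝ S := (convex_halfSpace_re_gt 0).inter
    ((convex_halfSpace_im_le _).inter (convex_halfSpace_im_ge _))
  set f : ℂ → ℂ := fun s => polylogSeries (r - 1) s - Real.Gamma r * s ^ (-(r : ℂ)) with hf
  -- Poisson summation is unavailable at exponent `r - 1`, which may be nonpositive. It applies to
  -- the derivative, whose exponent is `r > 0`.
  have hderiv : ∀ s ∈ S, HasDerivWithinAt f
      (-(polylogSeries r s - Real.Gamma (r + 1) * s ^ (-((r + 1 : ℝ) : ℂ)))) S s := by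
    intro s hs
    have hs0 : 0 < s.re := ((hSm s).1 hs).1
    have h1 := hasDerivAt_polylogSeries (r - 1) hs0
    have h2 := ((hasDerivAt_id s).cpow_const (c := -(r : ℂ)) (Or.inl hs0)).const_mul
      (Real.Gamma r : ℂ)
    refine ((h1.sub h2).congr_deriv ?_).hasDerivWithinAt
    rw [sub_add_cancel, Real.Gamma_add_one hr.ne']
    have : -((r + 1 : ℝ) : ℂ) = -(r : ℂ) - 1 := by
      push_cast
      ring
    rw [this]
    push_cast
    simp only [id]
    ring
  have hbd : ∀ s ∈ S,
      ‖-(polylogSeries r s - Real.Gamma (r + 1) * s ^ (-((r + 1 : ℝ) : ℂ)))‖ ≤ C := by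
    intro s hs
    rw [norm_neg]
    exact hC s ((hSm s).1 hs).1 ((hSm s).1 hs).2
  have hC0 : 0 ≤ C := (norm_nonneg _).trans (hbd 1 ((hSm 1).2 (by simp [Real.pi_pos.le])))
  have hlip : LipschitzOnWith C.toNNReal f S := by
    refine LipschitzOnWith.of_dist_le_mul fun x hx z hz => ?_
    rw [dist_eq_norm, dist_eq_norm, Real.coe_toNNReal _ hC0]
    exact hconv.norm_image_sub_le_of_norm_hasDerivWithin_le hderiv hbd hz hx
  -- A Lipschitz extension supplies a value at the boundary point `0`, namely the constant `E`; it
  -- is real because `f` is real on the positive axis.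
  obtain ⟨g, hg, hgf⟩ := hlip.extend_finite_dimension
  set D : ℝ := ((lipschitzExtensionConstant ℂ * C.toNNReal : NNReal) : ℝ) with hD
  have hD0 : 0 ≤ D := NNReal.coe_nonneg _
  have hle : ∀ s ∈ S, ‖f s - g 0‖ ≤ D * ‖s‖ := by
    intro s hs
    rw [hgf hs]
    have h := hg.dist_le_mul s 0
    rwa [dist_eq_norm, dist_zero_right] at h
  have him : (g 0).im = 0 := by
    have h1 : ∀ σ : ℝ, 0 < σ → |(g 0).im| ≤ D * σ := by
      intro σ hσ
      have h2 := hle σ ((hSm _).2 (by simp [hσ, Real.pi_pos.le]))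
      obtain ⟨x, hx⟩ := polylogSeries_ofReal (r - 1) σ
      have h3 : f σ = ((x - Real.Gamma r * σ ^ (-r) : ℝ) : ℂ) := by
        simp only [hf, hx]
        rw [← Complex.ofReal_neg, ← Complex.ofReal_cpow hσ.le]
        push_cast
        rfl
      have h4 := (Complex.abs_im_le_norm _).trans h2
      rw [h3, Complex.sub_im, Complex.ofReal_im, zero_sub, abs_neg, Complex.norm_real,
        Real.norm_of_nonneg hσ.le] at h4
      exact h4
    by_contra hne
    have hpos : 0 < |(g 0).im| := abs_pos.2 hne
    have h2 := h1 (|(g 0).im| / (2 * (D + 1))) (by positivity)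
    have h3 : D * (|(g 0).im| / (2 * (D + 1))) ≤ |(g 0).im| / 2 := by
      rw [← mul_div_assoc, div_le_div_iff₀ (by positivity) (by positivity)]
      nlinarith
    linarith
  have hreal : g 0 = ((g 0).re : ℂ) := Complex.ext (by simp) (by simp [him])
  refine ⟨(g 0).re, D, hD0, fun s hs hs' => ?_⟩
  rw [← hreal]
  exact hle s ((hSm s).2 ⟨hs, hs'⟩)

/-! ### Local and global estimates of the exponent. -/

/-- The second-order Taylor remainder `(1 - iτ) ^ (-r) - 1 - irτ`. -/
noncomputable def cpowTaylorRemainder (r τ : ℝ) : ℂ :=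
  (1 - τ * Complex.I) ^ (-(r : ℂ)) - 1 - r * τ * Complex.I

theorem choose_two_complex (a : ℂ) : Ring.choose a 2 = a * (a - 1) / 2 := by
  have h := Ring.descPochhammer_eq_factorial_smul_choose a 2
  have h2 : (descPochhammer ℤ 2).smeval a = a * (a - 1) := by
    rw [descPochhammer_succ_right, Polynomial.smeval_mul]
    simp [Polynomial.smeval_sub, Polynomial.smeval_X]
  rw [h2, Nat.factorial_two, two_nsmul] at h
  rw [h]
  ring

theorem cpowTaylorRemainder_isBigO (r : ℝ) :
    (fun τ : ℝ => cpowTaylorRemainder r τ + (r * (r + 1) / 2 * τ ^ 2 : ℝ)) =O[nhds 0]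
      fun τ : ℝ => τ ^ 3 := by
  have h := (Complex.one_add_cpow_hasFPowerSeriesAt_zero (a := -(r : ℂ))).isBigO_sub_partialSum_pow 3
  have ht : Tendsto (fun τ : ℝ => -((τ : ℂ) * Complex.I)) (nhds 0) (nhds 0) :=
    Continuous.tendsto' (by fun_prop) _ _ (by simp)
  have h2 := h.comp_tendsto ht
  refine (h2.congr_left (fun τ => ?_)).trans (IsBigO.of_bound 1 (Eventually.of_forall fun τ => ?_))
  · simp only [Function.comp, zero_add, FormalMultilinearSeries.partialSum, Finset.sum_range_succ,
      Finset.sum_range_zero, binomialSeries_apply, List.ofFn_const, List.prod_replicate,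
      Ring.choose_zero_right, Ring.choose_one_right, choose_two_complex, smul_eq_mul,
      cpowTaylorRemainder]
    push_cast
    rw [neg_sq, mul_pow, Complex.I_sq]
    ring_nf
  · simp

/-- At `τ = σ ^ (r / 2) u` the quadratic term times `σ ^ (-r)` is independent of `σ`, while the
cubic error is `O(σ ^ (r / 2))`. -/
theorem tendsto_rpow_mul_cpowTaylorRemainder {r : ℝ} (hr : 0 < r) (u : ℝ) :
    Tendsto (fun σ : ℝ => ((σ ^ (-r) : ℝ) : ℂ) * cpowTaylorRemainder r (σ ^ (r / 2) * u))
      (nhdsWithin 0 (Set.Ioi 0)) (nhds (-(r * (r + 1) / 2 * u ^ 2 : ℝ))) := by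
  obtain ⟨C, hC⟩ := (cpowTaylorRemainder_isBigO r).bound
  have hpow : Tendsto (fun σ : ℝ => σ ^ (r / 2)) (nhdsWithin 0 (Set.Ioi 0)) (nhds 0) := by
    have h : ContinuousAt (fun σ : ℝ => σ ^ (r / 2)) 0 :=
      Real.continuousAt_rpow_const _ _ (Or.inr (by linarith))
    have h' := h.tendsto
    rw [Real.zero_rpow (by linarith)] at h'
    exact h'.mono_left nhdsWithin_le_nhds
  have hτ : Tendsto (fun σ : ℝ => σ ^ (r / 2) * u) (nhdsWithin 0 (Set.Ioi 0)) (nhds 0) := by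
    simpa using hpow.mul_const u
  rw [tendsto_iff_norm_sub_tendsto_zero]
  have hz : Tendsto (fun σ : ℝ => C * |u| ^ 3 * σ ^ (r / 2)) (nhdsWithin 0 (Set.Ioi 0))
      (nhds 0) := by
    simpa using hpow.const_mul (C * |u| ^ 3)
  refine squeeze_zero' (Eventually.of_forall fun _ => norm_nonneg _) ?_ hz
  filter_upwards [hτ.eventually hC, self_mem_nhdsWithin] with σ h hσ
  have hσ' : (0 : ℝ) < σ := hσ
  have h1 : σ ^ (-r) * σ ^ (r / 2) * σ ^ (r / 2) = 1 := by
    rw [← Real.rpow_add hσ', ← Real.rpow_add hσ']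
    convert Real.rpow_zero σ using 2
    ring
  have h2 : ((σ ^ (-r) : ℝ) : ℂ) * cpowTaylorRemainder r (σ ^ (r / 2) * u) -
      -(r * (r + 1) / 2 * u ^ 2 : ℝ) = ((σ ^ (-r) : ℝ) : ℂ) *
      (cpowTaylorRemainder r (σ ^ (r / 2) * u) +
        (r * (r + 1) / 2 * (σ ^ (r / 2) * u) ^ 2 : ℝ)) := by
    have h3 : r * (r + 1) / 2 * u ^ 2 =
        σ ^ (-r) * (r * (r + 1) / 2 * (σ ^ (r / 2) * u) ^ 2) := by
      linear_combination -(r * (r + 1) / 2 * u ^ 2) * h1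
    rw [h3]
    push_cast
    ring
  rw [← Complex.ofReal_neg] at h2 ⊢
  rw [h2, norm_mul, Complex.norm_real, Real.norm_of_nonneg (by positivity)]
  calc σ ^ (-r) * _ ≤ σ ^ (-r) * (C * ‖(σ ^ (r / 2) * u) ^ 3‖) := by gcongr
    _ = C * |u| ^ 3 * σ ^ (r / 2) := by
      rw [norm_pow, norm_mul, Real.norm_of_nonneg (by positivity : 0 ≤ σ ^ (r / 2)),
        Real.norm_eq_abs]
      linear_combination C * |u| ^ 3 * σ ^ (r / 2) * h1

/-- The linear term is purely imaginary and `|1 - iτ| ^ (-r) = (1 + τ²) ^ (-r / 2)`. Bernoulli's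
inequality for exponents at most `1` explains the minimum. -/
theorem cpowTaylorRemainder_re_le {r : ℝ} (hr : 0 < r) (τ : ℝ) :
    (cpowTaylorRemainder r τ).re ≤ -(min (r / 2) 1 * (τ ^ 2 / (1 + τ ^ 2))) := by
  have h0 : (0 : ℝ) < 1 + τ ^ 2 := by positivity
  have hnorm : ‖(1 - τ * Complex.I : ℂ)‖ = (1 + τ ^ 2) ^ (1 / 2 : ℝ) := by
    rw [← Real.sqrt_eq_rpow, Complex.norm_def, Complex.normSq_apply]
    congr 1
    simp
    ring
  have h1 : ‖(1 - τ * Complex.I : ℂ) ^ (-(r : ℂ))‖ = ((1 + τ ^ 2)⁻¹) ^ (r / 2) := by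
    rw [← Complex.ofReal_neg, Complex.norm_cpow_real, hnorm, ← Real.rpow_mul h0.le,
      Real.inv_rpow h0.le, ← Real.rpow_neg h0.le]
    congr 1
    ring
  have h2 : (cpowTaylorRemainder r τ).re = ((1 - τ * Complex.I : ℂ) ^ (-(r : ℂ))).re - 1 := by
    simp [cpowTaylorRemainder, ← Complex.ofReal_mul]
  have h3 := Complex.re_le_norm ((1 - τ * Complex.I : ℂ) ^ (-(r : ℂ)))
  have h4 : (1 + τ ^ 2)⁻¹ = 1 + -(τ ^ 2 / (1 + τ ^ 2)) := by
    field_simp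
    ring
  have ht0 : 0 ≤ τ ^ 2 / (1 + τ ^ 2) := by positivity
  have hinv : 0 < (1 + τ ^ 2)⁻¹ := by positivity
  have hinv1 : (1 + τ ^ 2)⁻¹ ≤ 1 := by linarith
  have h5 : ((1 + τ ^ 2)⁻¹) ^ (r / 2) ≤ 1 - min (r / 2) 1 * (τ ^ 2 / (1 + τ ^ 2)) := by
    have hm0 : 0 ≤ min (r / 2) 1 := le_min (by linarith) zero_le_one
    refine (Real.rpow_le_rpow_of_exponent_ge hinv hinv1 (min_le_left (r / 2) 1)).trans ?_
    have h6 := rpow_one_add_le_one_add_mul_self (s := -(τ ^ 2 / (1 + τ ^ 2)))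
      (by linarith) hm0 (min_le_right _ _)
    rw [← h4] at h6
    linarith
  linarith

/-! ### The saddle point integral. -/

/-- The integrand of the saddle point integral after rescaling the imaginary direction. -/
noncomputable def rescaledIntegrand (r A : ℝ) (R : ℂ → ℂ) (σ u : ℝ) : ℂ :=
  Complex.exp (A * (((σ ^ (-r) : ℝ) : ℂ) * cpowTaylorRemainder r (σ ^ (r / 2) * u)) +
    R (σ - (σ ^ (1 + r / 2) * u : ℝ) * Complex.I))

theorem cpow_neg_rescaled {r σ : ℝ} (hσ : 0 < σ) (u : ℝ) :
    ((σ : ℂ) - (σ ^ (1 + r / 2) * u : ℝ) * Complex.I) ^ (-(r : ℂ)) =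
      ((σ ^ (-r) : ℝ) : ℂ) * (1 - (σ ^ (r / 2) * u : ℝ) * Complex.I) ^ (-(r : ℂ)) := by
  have hne : (1 - (σ ^ (r / 2) * u : ℝ) * Complex.I : ℂ) ≠ 0 := by
    intro h
    have := congrArg Complex.re h
    simp at this
  have h1 : (σ : ℂ) - (σ ^ (1 + r / 2) * u : ℝ) * Complex.I =
      (σ : ℂ) * (1 - (σ ^ (r / 2) * u : ℝ) * Complex.I) := by
    rw [Real.rpow_add hσ, Real.rpow_one]
    push_cast
    ring
  have hσ' : (σ : ℂ) ≠ 0 := by exact_mod_cast hσ.ne'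
  rw [h1, Complex.cpow_def_of_ne_zero (mul_ne_zero hσ' hne), Complex.log_ofReal_mul hσ hne,
    Complex.cpow_def_of_ne_zero hne, add_mul, Complex.exp_add, Real.rpow_def_of_pos hσ (-r)]
  push_cast
  rfl

/-- The coefficient `r A σ ^ (-r - 1)` is the one that cancels the linear term in `u`; the constant
terms add up to `A (1 + r) σ ^ (-r)`. -/
theorem integral_eq_rescaled {r A σ : ℝ} (hσ : 0 < σ) (R : ℂ → ℂ) :
    ∫ θ in -Real.pi..Real.pi, Complex.exp (A * ((σ : ℂ) - θ * Complex.I) ^ (-(r : ℂ)) +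
        R (σ - θ * Complex.I) + (r * A * σ ^ (-r - 1) : ℝ) * (σ - θ * Complex.I)) =
      (σ ^ (1 + r / 2) * Real.exp (A * (1 + r) * σ ^ (-r)) : ℝ) *
        ∫ u in Set.Ioc (-(Real.pi / σ ^ (1 + r / 2))) (Real.pi / σ ^ (1 + r / 2)),
          rescaledIntegrand r A R σ u := by
  have hδ : 0 < σ ^ (1 + r / 2) := by positivity
  have h1 := intervalIntegral.smul_integral_comp_mul_left
    (a := -(Real.pi / σ ^ (1 + r / 2))) (b := Real.pi / σ ^ (1 + r / 2))
    (fun θ : ℝ => Complex.exp (A * ((σ : ℂ) - θ * Complex.I) ^ (-(r : ℂ)) +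
        R (σ - θ * Complex.I) + (r * A * σ ^ (-r - 1) : ℝ) * (σ - θ * Complex.I)))
    (σ ^ (1 + r / 2))
  rw [mul_neg, mul_div_cancel₀ _ hδ.ne'] at h1
  rw [← h1, Complex.real_smul, Complex.ofReal_mul (σ ^ (1 + r / 2)) (Real.exp _),
    mul_assoc (((σ ^ (1 + r / 2) : ℝ)) : ℂ)]
  congr 1
  rw [← intervalIntegral.integral_of_le (by
    have : 0 ≤ Real.pi / σ ^ (1 + r / 2) := by positivity
    linarith), ← intervalIntegral.integral_const_mul]
  refine intervalIntegral.integral_congr fun u _ => ?_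
  simp only [rescaledIntegrand]
  rw [cpow_neg_rescaled hσ, Complex.ofReal_exp, ← Complex.exp_add, cpowTaylorRemainder]
  congr 1
  have h2 : σ ^ (-r - 1) * σ = σ ^ (-r) := by
    rw [← Real.rpow_add_one hσ.ne']
    congr 1
    ring
  have h3 : σ ^ (-r - 1) * σ ^ (1 + r / 2) = σ ^ (-r) * σ ^ (r / 2) := by
    rw [← Real.rpow_add hσ, ← Real.rpow_add hσ]
    congr 1
    ring
  have h2' := congrArg Complex.ofReal h2
  have h3' := congrArg Complex.ofReal h3
  push_cast at h2' h3' ⊢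
  linear_combination (r : ℂ) * A * h2' - (r : ℂ) * A * u * Complex.I * h3'

theorem continuous_rescaledIntegrand {r A σ : ℝ} (hσ : 0 < σ) {R : ℂ → ℂ}
    (hR : ContinuousOn R {s | 0 < s.re}) : Continuous (rescaledIntegrand r A R σ) := by
  have h1 : Continuous fun u : ℝ => R (σ - (σ ^ (1 + r / 2) * u : ℝ) * Complex.I) :=
    hR.comp_continuous (by fun_prop) fun u => by simpa [← Complex.ofReal_mul] using hσ
  have h2 : Continuous fun u : ℝ =>
      (1 - (σ ^ (r / 2) * u : ℝ) * Complex.I : ℂ) ^ (-(r : ℂ)) := by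
    refine Continuous.cpow (by fun_prop) continuous_const fun u => Or.inl ?_
    simp
  exact ((continuous_const.mul (continuous_const.mul ((h2.sub continuous_const).sub
    (by fun_prop)))).add h1).cexp

/-- For `|τ| ≤ 1` the decay is Gaussian in `u`. For `|τ| ≥ 1` the factor `exp (-b σ ^ (-r))` beats
`1 + u²`, which is `O(σ ^ (-2 - r))` on the circle. The two entries of `B` match the two regimes. -/
theorem exists_norm_rescaledIntegrand_le {r A M : ℝ} (hr : 0 < r) (hA : 0 < A) {R : ℂ → ℂ}
    (hM : ∀ s : ℂ, 0 < s.re → s.re ≤ 1 → |s.im| ≤ Real.pi → ‖R s‖ ≤ M) :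
    ∃ B : ℝ, 0 ≤ B ∧ ∀ᶠ σ : ℝ in nhdsWithin 0 (Set.Ioi 0), ∀ u : ℝ,
      |u| ≤ Real.pi / σ ^ (1 + r / 2) → ‖rescaledIntegrand r A R σ u‖ ≤ B * (1 + u ^ 2)⁻¹ := by
  set c := min (r / 2) 1 with hc
  have hc0 : 0 < c := lt_min (by linarith) one_pos
  set b := A * c / 2 with hb
  have hb0 : 0 < b := by positivity
  have hsm : Tendsto (fun σ : ℝ => σ ^ (-r)) (nhdsWithin 0 (Set.Ioi 0)) atTop :=
    tendsto_rpow_neg_nhdsGT_zero (by linarith)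
  have hexp := (tendsto_rpow_mul_exp_neg_mul_atTop_nhds_zero ((2 + r) / r) b hb0).comp hsm
  set B := max (1 + b⁻¹) (1 + Real.pi ^ 2) with hB
  have hB0 : 0 ≤ B := le_max_of_le_right (by positivity)
  refine ⟨B * Real.exp M, by positivity, ?_⟩
  filter_upwards [hexp.eventually (eventually_le_nhds zero_lt_one), self_mem_nhdsWithin,
    nhdsWithin_le_nhds (eventually_le_nhds (zero_lt_one' ℝ))] with σ h1 hσ0 hσ1 u hu
  have hσ : (0 : ℝ) < σ := hσ0
  have hσr : 0 < σ ^ (-r) := by positivity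
  have hδ : 0 < σ ^ (1 + r / 2) := by positivity
  have hRM : ‖R (σ - (σ ^ (1 + r / 2) * u : ℝ) * Complex.I)‖ ≤ M := by
    refine hM _ (by simpa [← Complex.ofReal_mul] using hσ)
      (by simpa [← Complex.ofReal_mul] using hσ1) ?_
    have : ((σ : ℂ) - (σ ^ (1 + r / 2) * u : ℝ) * Complex.I).im = -(σ ^ (1 + r / 2) * u) := by
      rw [Complex.sub_im, Complex.ofReal_im, Complex.im_ofReal_mul, Complex.I_im]
      ring
    rw [this, abs_neg, abs_mul, abs_of_pos hδ, mul_comm]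
    exact (le_div_iff₀ hδ).1 hu
  set τ := σ ^ (r / 2) * u with hτ
  have hτu : σ ^ (-r) * τ ^ 2 = u ^ 2 := by
    have : σ ^ (-r) * σ ^ (r / 2) * σ ^ (r / 2) = 1 := by
      rw [← Real.rpow_add hσ, ← Real.rpow_add hσ]
      convert Real.rpow_zero σ using 2
      ring
    rw [hτ]
    linear_combination u ^ 2 * this
  have hre : ‖rescaledIntegrand r A R σ u‖ ≤
      Real.exp (-(A * c * (σ ^ (-r) * (τ ^ 2 / (1 + τ ^ 2))))) * Real.exp M := by
    rw [rescaledIntegrand, Complex.norm_exp, ← Real.exp_add]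
    refine Real.exp_le_exp.2 ?_
    rw [Complex.add_re, Complex.re_ofReal_mul, Complex.re_ofReal_mul]
    refine add_le_add ?_ ((Complex.re_le_norm _).trans hRM)
    have h2 := mul_le_mul_of_nonneg_left (cpowTaylorRemainder_re_le hr τ)
      (show 0 ≤ A * σ ^ (-r) by positivity)
    rw [← hc] at h2
    rw [← hτ]
    linarith
  refine hre.trans ?_
  rw [mul_right_comm B]
  refine mul_le_mul_of_nonneg_right ?_ (Real.exp_pos M).le
  have hu0 : 0 < 1 + u ^ 2 := by positivity
  rw [← div_eq_mul_inv, le_div_iff₀ hu0]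
  rcases le_total (τ ^ 2) 1 with hτ1 | hτ1
  · have h3 : b * u ^ 2 ≤ A * c * (σ ^ (-r) * (τ ^ 2 / (1 + τ ^ 2))) := by
      have h4 : τ ^ 2 / 2 ≤ τ ^ 2 / (1 + τ ^ 2) :=
        div_le_div_of_nonneg_left (sq_nonneg _) (by positivity) (by linarith)
      have h5 := mul_le_mul_of_nonneg_left h4 (show 0 ≤ A * c * σ ^ (-r) by positivity)
      rw [← hτu, hb]
      linarith
    have h6 : Real.exp (-(A * c * (σ ^ (-r) * (τ ^ 2 / (1 + τ ^ 2))))) ≤ (1 + b * u ^ 2)⁻¹ := by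
      rw [Real.exp_neg]
      refine inv_anti₀ (by positivity) ?_
      have := Real.add_one_le_exp (A * c * (σ ^ (-r) * (τ ^ 2 / (1 + τ ^ 2))))
      linarith
    have h7 : 1 + u ^ 2 ≤ (1 + b⁻¹) * (1 + b * u ^ 2) := by
      have : (1 + b⁻¹) * (1 + b * u ^ 2) = 1 + u ^ 2 + b⁻¹ + b * u ^ 2 := by
        field_simp
        ring
      rw [this]
      have : 0 ≤ b⁻¹ + b * u ^ 2 := by positivity
      linarith
    have h8 : 0 < 1 + b * u ^ 2 := by positivity
    calc _ ≤ (1 + b * u ^ 2)⁻¹ * ((1 + b⁻¹) * (1 + b * u ^ 2)) := by gcongr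
      _ = 1 + b⁻¹ := by field_simp
      _ ≤ B := le_max_left _ _
  · have h3 : b * σ ^ (-r) ≤ A * c * (σ ^ (-r) * (τ ^ 2 / (1 + τ ^ 2))) := by
      have h4 : 1 / 2 ≤ τ ^ 2 / (1 + τ ^ 2) := by
        rw [div_le_div_iff₀ (by norm_num) (by positivity)]
        linarith
      have h5 := mul_le_mul_of_nonneg_left h4 (show 0 ≤ A * c * σ ^ (-r) by positivity)
      rw [hb]
      linarith
    have h6 : (σ ^ (-r)) ^ ((2 + r) / r) = (σ ^ (1 + r / 2))⁻¹ ^ 2 := by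
      rw [← Real.rpow_mul hσ.le, ← Real.rpow_neg hσ.le, ← Real.rpow_natCast,
        ← Real.rpow_mul hσ.le]
      congr 1
      push_cast
      field_simp
    have h7 : 1 + u ^ 2 ≤ (1 + Real.pi ^ 2) * (σ ^ (-r)) ^ ((2 + r) / r) := by
      rw [h6]
      have h8 : 1 ≤ (σ ^ (1 + r / 2))⁻¹ :=
        (one_le_inv₀ hδ).2 (Real.rpow_le_one hσ.le hσ1 (by linarith))
      have h9 : u ^ 2 ≤ (Real.pi * (σ ^ (1 + r / 2))⁻¹) ^ 2 := by
        rw [← div_eq_mul_inv]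
        exact sq_le_sq' (abs_le.1 hu).1 (abs_le.1 hu).2
      have h10 : 1 ≤ (σ ^ (1 + r / 2))⁻¹ ^ 2 := one_le_pow₀ h8
      rw [mul_pow] at h9
      linarith
    have h1' : (σ ^ (-r)) ^ ((2 + r) / r) * Real.exp (-b * σ ^ (-r)) ≤ 1 := h1
    calc _ ≤ Real.exp (-b * σ ^ (-r)) * ((1 + Real.pi ^ 2) * (σ ^ (-r)) ^ ((2 + r) / r)) := by
          refine mul_le_mul (Real.exp_le_exp.2 (by linarith)) h7 hu0.le (Real.exp_pos _).le
      _ = (1 + Real.pi ^ 2) *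
          ((σ ^ (-r)) ^ ((2 + r) / r) * Real.exp (-b * σ ^ (-r))) := by ring
      _ ≤ (1 + Real.pi ^ 2) * 1 := by gcongr
      _ ≤ B := by
          rw [mul_one]
          exact le_max_right _ _

/-- **Saddle point asymptotics** for a function behaving like `exp (A s ^ (-r))` at the origin. -/
theorem tendsto_saddle_integral {r A R₀ M : ℝ} (hr : 0 < r) (hA : 0 < A) {R : ℂ → ℂ}
    (hRc : ContinuousOn R {s | 0 < s.re})
    (hM : ∀ s : ℂ, 0 < s.re → s.re ≤ 1 → |s.im| ≤ Real.pi → ‖R s‖ ≤ M)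
    (hR0 : Tendsto R (nhdsWithin 0 {s | 0 < s.re}) (nhds R₀)) :
    Tendsto (fun σ : ℝ => ((σ ^ (1 + r / 2) * Real.exp (A * (1 + r) * σ ^ (-r)) : ℝ) : ℂ)⁻¹ *
        ∫ θ in -Real.pi..Real.pi, Complex.exp (A * ((σ : ℂ) - θ * Complex.I) ^ (-(r : ℂ)) +
          R (σ - θ * Complex.I) + (r * A * σ ^ (-r - 1) : ℝ) * (σ - θ * Complex.I)))
      (nhdsWithin 0 (Set.Ioi 0))
      (nhds ((Real.exp R₀ * √(Real.pi / (A * (r * (r + 1) / 2))) : ℝ) : ℂ)) := by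
  obtain ⟨B, hB0, hB⟩ := exists_norm_rescaledIntegrand_le hr hA hM
  have hδ0 : Tendsto (fun σ : ℝ => σ ^ (1 + r / 2)) (nhdsWithin 0 (Set.Ioi 0))
      (nhdsWithin 0 (Set.Ioi 0)) := by
    refine tendsto_nhdsWithin_of_tendsto_nhds_of_eventually_within _ ?_ ?_
    · have h : ContinuousAt (fun σ : ℝ => σ ^ (1 + r / 2)) 0 :=
        Real.continuousAt_rpow_const _ _ (Or.inr (by linarith))
      have h' := h.tendsto
      rw [Real.zero_rpow (by linarith)] at h'
      exact h'.mono_left nhdsWithin_le_nhds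
    · filter_upwards [self_mem_nhdsWithin] with σ hσ
      exact Real.rpow_pos_of_pos hσ _
  -- The indicator places the growing intervals on one line, so that dominated convergence applies.
  have hdc : Tendsto (fun σ : ℝ => ∫ u : ℝ,
      (Set.Ioc (-(Real.pi / σ ^ (1 + r / 2))) (Real.pi / σ ^ (1 + r / 2))).indicator
        (rescaledIntegrand r A R σ) u) (nhdsWithin 0 (Set.Ioi 0))
      (nhds (∫ u : ℝ, ((Real.exp R₀ * Real.exp (-(A * (r * (r + 1) / 2)) * u ^ 2) : ℝ) : ℂ))) := by
    refine MeasureTheory.tendsto_integral_filter_of_dominated_convergence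
      (fun u => B * (1 + u ^ 2)⁻¹) ?_ ?_ (integrable_inv_one_add_sq.const_mul B) ?_
    · filter_upwards [self_mem_nhdsWithin] with σ hσ
      exact (continuous_rescaledIntegrand hσ hRc).aestronglyMeasurable.indicator
        measurableSet_Ioc
    · filter_upwards [hB] with σ h
      refine Eventually.of_forall fun u => ?_
      by_cases hu : u ∈ Set.Ioc (-(Real.pi / σ ^ (1 + r / 2))) (Real.pi / σ ^ (1 + r / 2))
      · rw [Set.indicator_of_mem hu]
        exact h u (abs_le.2 ⟨hu.1.le, hu.2⟩)
      · rw [Set.indicator_of_notMem hu, norm_zero]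
        positivity
    · refine Eventually.of_forall fun u => ?_
      have hlarge : Tendsto (fun σ : ℝ => Real.pi / σ ^ (1 + r / 2))
          (nhdsWithin 0 (Set.Ioi 0)) atTop := by
        simp_rw [div_eq_mul_inv]
        exact (tendsto_inv_nhdsGT_zero.comp hδ0).const_mul_atTop Real.pi_pos
      have hs : Tendsto (fun σ : ℝ => (σ : ℂ) - (σ ^ (1 + r / 2) * u : ℝ) * Complex.I)
          (nhdsWithin 0 (Set.Ioi 0)) (nhdsWithin 0 {s | 0 < s.re}) := by
        refine tendsto_nhdsWithin_of_tendsto_nhds_of_eventually_within _ ?_ ?_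
        · have h1 : Tendsto (fun σ : ℝ => (σ : ℂ)) (nhdsWithin 0 (Set.Ioi 0)) (nhds 0) :=
            (Complex.continuous_ofReal.tendsto' 0 0 (by simp)).mono_left nhdsWithin_le_nhds
          have h2 : Tendsto (fun σ : ℝ => ((σ ^ (1 + r / 2) * u : ℝ) : ℂ) * Complex.I)
              (nhdsWithin 0 (Set.Ioi 0)) (nhds 0) := by
            have h3 : Tendsto (fun x : ℝ => ((x * u : ℝ) : ℂ) * Complex.I) (nhds 0) (nhds 0) :=
              Continuous.tendsto' (by fun_prop) _ _ (by simp)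
            exact h3.comp (hδ0.mono_right nhdsWithin_le_nhds)
          simpa using h1.sub h2
        · filter_upwards [self_mem_nhdsWithin] with σ hσ
          simpa [← Complex.ofReal_mul] using hσ
      have hlim : Tendsto (fun σ : ℝ => rescaledIntegrand r A R σ u) (nhdsWithin 0 (Set.Ioi 0))
          (nhds ((Real.exp R₀ * Real.exp (-(A * (r * (r + 1) / 2)) * u ^ 2) : ℝ) : ℂ)) := by
        have h1 := (((tendsto_rpow_mul_cpowTaylorRemainder hr u).const_mul (A : ℂ)).add
          (hR0.comp hs)).cexp
        have h2 : ((Real.exp R₀ * Real.exp (-(A * (r * (r + 1) / 2)) * u ^ 2) : ℝ) : ℂ) =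
            Complex.exp (A * -((r * (r + 1) / 2 * u ^ 2 : ℝ) : ℂ) + R₀) := by
          rw [← Real.exp_add]
          push_cast
          congr 1
          ring
        rw [h2]
        exact h1
      refine hlim.congr' ?_
      filter_upwards [hlarge.eventually_gt_atTop |u|] with σ h
      rw [Set.indicator_of_mem]
      exact ⟨(abs_lt.1 h).1, (abs_lt.1 h).2.le⟩
  rw [integral_complex_ofReal, MeasureTheory.integral_const_mul, integral_gaussian] at hdc
  refine hdc.congr' ?_
  filter_upwards [self_mem_nhdsWithin] with σ hσ
  have hσ' : (0 : ℝ) < σ := hσ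
  rw [integral_eq_rescaled hσ', MeasureTheory.integral_indicator measurableSet_Ioc,
    inv_mul_cancel_left₀]
  exact_mod_cast (by positivity : σ ^ (1 + r / 2) * Real.exp (A * (1 + r) * σ ^ (-r)) ≠ 0)

/-! ### The summable part of the logarithm and coefficient asymptotics. -/

/-- `∑ h m * exp (-m s)`, summed over the positive integers `m`. -/
noncomputable def exponentialSum (h : ℕ → ℝ) (s : ℂ) : ℂ :=
  ∑' m : ℕ, (h (m + 1) : ℂ) * Complex.exp (-(((m + 1 : ℕ) : ℂ) * s))

theorem norm_exponentialSum_term_le (h : ℕ → ℝ) {s : ℂ} (hs : 0 ≤ s.re) (m : ℕ) :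
    ‖(h (m + 1) : ℂ) * Complex.exp (-(((m + 1 : ℕ) : ℂ) * s))‖ ≤ |h (m + 1)| := by
  rw [norm_mul, Complex.norm_real, Complex.norm_exp, Real.norm_eq_abs]
  refine mul_le_of_le_one_right (abs_nonneg _) (Real.exp_le_one_iff.2 ?_)
  rw [Complex.neg_re, ← Complex.ofReal_natCast, Complex.re_ofReal_mul]
  have : 0 ≤ ((m + 1 : ℕ) : ℝ) * s.re := by positivity
  linarith

theorem summable_abs_shift {h : ℕ → ℝ} (hh : Summable h) : Summable fun m => |h (m + 1)| :=
  ((summable_nat_add_iff 1).2 hh).abs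

theorem continuousOn_exponentialSum {h : ℕ → ℝ} (hh : Summable h) :
    ContinuousOn (exponentialSum h) {s | 0 ≤ s.re} :=
  continuousOn_tsum (fun m => by fun_prop) (summable_abs_shift hh)
    fun m _ hs => norm_exponentialSum_term_le h hs m

theorem norm_exponentialSum_le {h : ℕ → ℝ} (hh : Summable h) {s : ℂ} (hs : 0 ≤ s.re) :
    ‖exponentialSum h s‖ ≤ ∑' m, |h (m + 1)| :=
  tsum_of_norm_bounded (summable_abs_shift hh).hasSum (norm_exponentialSum_term_le h hs)

theorem exponentialSum_zero (h : ℕ → ℝ) :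
    exponentialSum h 0 = ((∑' m, h (m + 1) : ℝ) : ℂ) := by
  simp [exponentialSum, Complex.ofReal_tsum]

theorem summable_coeff_mul_pow {l : ℕ → ℝ} {K r : ℝ}
    (hl : Summable fun m : ℕ => l m - K * (m : ℝ) ^ (r - 1)) {ρ : ℝ} (hρ0 : 0 ≤ ρ) (hρ1 : ρ < 1) :
    Summable fun m => ‖(l m : ℂ)‖ * ρ ^ m := by
  -- Replacing `ρ` by a positive `q` allows `q ^ m = exp (m log q)` even if `ρ = 0`.
  set q := max ρ (1 / 2) with hq
  have hq0 : 0 < q := lt_max_of_lt_right (by norm_num)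
  have hq1 : q < 1 := max_lt hρ1 (by norm_num)
  have hlog : 0 < -Real.log q := by
    have := Real.log_neg hq0 hq1
    linarith
  have h1 := (summable_rpow_mul_exp_neg (r - 1) hlog).mul_left |K|
  refine (summable_nat_add_iff 1).1
    (Summable.of_nonneg_of_le (fun m => by positivity) (fun m => ?_)
      (h1.add (summable_abs_shift hl)))
  have hexp : Real.exp (-(((m + 1 : ℕ) : ℝ) * -Real.log q)) = q ^ (m + 1) := by
    rw [← mul_neg, neg_neg, Real.exp_nat_mul, Real.exp_log hq0]
  have hρq : ρ ^ (m + 1) ≤ q ^ (m + 1) := pow_le_pow_left₀ hρ0 (le_max_left _ _) _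
  have hle1 : ρ ^ (m + 1) ≤ 1 := pow_le_one₀ hρ0 hρ1.le
  rw [Complex.norm_real, Real.norm_eq_abs, hexp]
  have hp : 0 ≤ ((m + 1 : ℕ) : ℝ) ^ (r - 1) := by positivity
  have h2 : |l (m + 1)| ≤ |K| * ((m + 1 : ℕ) : ℝ) ^ (r - 1) +
      |l (m + 1) - K * ((m + 1 : ℕ) : ℝ) ^ (r - 1)| := by
    have := abs_add_le (K * ((m + 1 : ℕ) : ℝ) ^ (r - 1))
      (l (m + 1) - K * ((m + 1 : ℕ) : ℝ) ^ (r - 1))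
    rwa [add_sub_cancel, abs_mul, abs_of_nonneg hp] at this
  calc |l (m + 1)| * ρ ^ (m + 1)
      ≤ (|K| * ((m + 1 : ℕ) : ℝ) ^ (r - 1) +
          |l (m + 1) - K * ((m + 1 : ℕ) : ℝ) ^ (r - 1)|) * ρ ^ (m + 1) := by gcongr
    _ = |K| * (((m + 1 : ℕ) : ℝ) ^ (r - 1) * ρ ^ (m + 1)) +
          |l (m + 1) - K * ((m + 1 : ℕ) : ℝ) ^ (r - 1)| * ρ ^ (m + 1) := by ring
    _ ≤ |K| * (((m + 1 : ℕ) : ℝ) ^ (r - 1) * q ^ (m + 1)) +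
          |l (m + 1) - K * ((m + 1 : ℕ) : ℝ) ^ (r - 1)| := by
        refine add_le_add (by gcongr) (mul_le_of_le_one_right (abs_nonneg _) hle1)

theorem tsum_coeff_eq {l : ℕ → ℝ} {K r : ℝ} (hl0 : l 0 = 0)
    (hl : Summable fun m : ℕ => l m - K * (m : ℝ) ^ (r - 1)) {s : ℂ} (hs : 0 < s.re) :
    ∑' m : ℕ, (l m : ℂ) * Complex.exp (-(m * s)) =
      K * polylogSeries (r - 1) s +
        exponentialSum (fun m : ℕ => l m - K * (m : ℝ) ^ (r - 1)) s := by
  have h1 := (summable_polylogSeries (r - 1) hs).mul_left (K : ℂ)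
  have h2 : Summable fun m : ℕ => ((l (m + 1) - K * ((m + 1 : ℕ) : ℝ) ^ (r - 1) : ℝ) : ℂ) *
      Complex.exp (-(((m + 1 : ℕ) : ℂ) * s)) :=
    Summable.of_norm_bounded (summable_abs_shift hl)
      (norm_exponentialSum_term_le (fun m : ℕ => l m - K * (m : ℝ) ^ (r - 1)) hs.le)
  have h3 : ∀ m : ℕ, (l (m + 1) : ℂ) * Complex.exp (-(((m + 1 : ℕ) : ℂ) * s)) =
      K * (((((m + 1 : ℕ) : ℝ) ^ (r - 1) : ℝ) : ℂ) * Complex.exp (-(((m + 1 : ℕ) : ℂ) * s))) +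
      ((l (m + 1) - K * ((m + 1 : ℕ) : ℝ) ^ (r - 1) : ℝ) : ℂ) *
        Complex.exp (-(((m + 1 : ℕ) : ℂ) * s)) := by
    intro m
    rw [Complex.ofReal_sub, Complex.ofReal_mul]
    ring
  have h4 : Summable fun m : ℕ => (l m : ℂ) * Complex.exp (-(m * s)) := by
    refine (summable_nat_add_iff 1).1 ?_
    simp_rw [h3]
    exact h1.add h2
  rw [h4.tsum_eq_zero_add, hl0, Complex.ofReal_zero, zero_mul, zero_add, tsum_congr h3,
    h1.tsum_add h2, tsum_mul_left]
  rfl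

/-- Asymptotics of the coefficients of `exp (∑ l m x ^ m)` along the saddle points. -/
theorem exists_tendsto_coeff_along_saddle {l b : ℕ → ℝ} {K r : ℝ} (hK : 0 < K) (hr : 0 < r)
    (hl0 : l 0 = 0) (hl : Summable fun m : ℕ => l m - K * (m : ℝ) ^ (r - 1)) (hb0 : b 0 = 1)
    (hrec : ∀ n : ℕ, (n : ℝ) * b n = ∑ m ∈ Finset.Icc 1 n, m * l m * b (n - m)) :
    ∃ L : ℝ, 0 < L ∧ ∀ σ : ℕ → ℝ, Tendsto σ atTop (nhdsWithin 0 (Set.Ioi 0)) →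
      (∀ᶠ n : ℕ in atTop, r * (K * Real.Gamma r) * σ n ^ (-r - 1) = n) →
      Tendsto (fun n => b n /
        (σ n ^ (1 + r / 2) * Real.exp (K * Real.Gamma r * (1 + r) * σ n ^ (-r)))) atTop (nhds L) := by
  obtain ⟨E, C, hC0, hE⟩ := exists_polylogSeries_expansion hr
  set h : ℕ → ℝ := fun m : ℕ => l m - K * (m : ℝ) ^ (r - 1) with hh
  set A := K * Real.Gamma r with hA
  have hA0 : 0 < A := mul_pos hK (Real.Gamma_pos_of_pos hr)
  -- All of the logarithm except `A s ^ (-r)`; asymptotically it contributes only the factor `exp`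
  -- of its limit at `0`.
  set R : ℂ → ℂ := fun s =>
    K * (polylogSeries (r - 1) s - Real.Gamma r * s ^ (-(r : ℂ))) + exponentialSum h s with hR
  have hseries : ∀ s : ℂ, 0 < s.re →
      ∑' m : ℕ, (l m : ℂ) * Complex.exp (-(m * s)) = A * s ^ (-(r : ℂ)) + R s := by
    intro s hs
    rw [tsum_coeff_eq hl0 hl hs, hR, hA]
    push_cast
    ring
  have hRc : ContinuousOn R {s | 0 < s.re} := by
    have h1 : ContinuousOn (polylogSeries (r - 1)) {s | 0 < s.re} := fun s hs =>
      (hasDerivAt_polylogSeries (r - 1) hs).continuousAt.continuousWithinAt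
    have h2 : ContinuousOn (fun s : ℂ => s ^ (-(r : ℂ))) {s | 0 < s.re} :=
      continuousOn_id.cpow continuousOn_const fun s hs => Or.inl hs
    have h3 : ContinuousOn (exponentialSum h) {s | 0 < s.re} :=
      (continuousOn_exponentialSum hl).mono fun s (hs : 0 < s.re) => hs.le
    exact (continuousOn_const.mul (h1.sub (continuousOn_const.mul h2))).add h3
  have hM : ∀ s : ℂ, 0 < s.re → s.re ≤ 1 → |s.im| ≤ Real.pi →
      ‖R s‖ ≤ K * (C * (1 + Real.pi) + |E|) + ∑' m, |h (m + 1)| := by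
    intro s hs hs1 him
    refine (norm_add_le _ _).trans (add_le_add ?_ (norm_exponentialSum_le hl hs.le))
    rw [norm_mul, Complex.norm_real, Real.norm_of_nonneg hK.le]
    refine mul_le_mul_of_nonneg_left ?_ hK.le
    have h1 := norm_le_norm_sub_add
      (polylogSeries (r - 1) s - Real.Gamma r * s ^ (-(r : ℂ))) (E : ℂ)
    have h2 : ‖s‖ ≤ 1 + Real.pi := by
      refine (Complex.norm_le_abs_re_add_abs_im s).trans ?_
      rw [abs_of_pos hs]
      exact add_le_add hs1 him
    rw [Complex.norm_real, Real.norm_eq_abs] at h1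
    exact h1.trans (add_le_add ((hE s hs him).trans (by gcongr)) le_rfl)
  have hR0 : Tendsto R (nhdsWithin 0 {s | 0 < s.re})
      (nhds ((K * E + ∑' m, h (m + 1) : ℝ) : ℂ)) := by
    have h1 : Tendsto (fun s => polylogSeries (r - 1) s - Real.Gamma r * s ^ (-(r : ℂ)))
        (nhdsWithin 0 {s | 0 < s.re}) (nhds (E : ℂ)) := by
      rw [tendsto_iff_norm_sub_tendsto_zero]
      have h2 : Tendsto (fun s : ℂ => C * ‖s‖) (nhdsWithin 0 {s | 0 < s.re}) (nhds 0) :=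
        (Continuous.tendsto' (by fun_prop) _ _ (by simp)).mono_left nhdsWithin_le_nhds
      refine squeeze_zero' (Eventually.of_forall fun _ => norm_nonneg _) ?_ h2
      have h3 : ∀ᶠ s : ℂ in nhds 0, |s.im| < Real.pi :=
        (isOpen_lt (by fun_prop) continuous_const).mem_nhds
          (by simpa using Real.pi_pos : |(0 : ℂ).im| < Real.pi)
      filter_upwards [self_mem_nhdsWithin, nhdsWithin_le_nhds h3] with s hs him
      exact hE s hs him.le
    have h4 : Tendsto (exponentialSum h) (nhdsWithin 0 {s | 0 < s.re})
        (nhds (exponentialSum h 0)) :=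
      ((continuousOn_exponentialSum hl) 0 (by simp)).mono fun s (hs : 0 < s.re) => hs.le
    rw [exponentialSum_zero] at h4
    rw [Complex.ofReal_add, Complex.ofReal_mul]
    exact (h1.const_mul _).add h4
  have hsaddle := tendsto_saddle_integral hr hA0 hRc hM hR0
  set J := Real.exp (K * E + ∑' m, h (m + 1)) * √(Real.pi / (A * (r * (r + 1) / 2))) with hJ
  have hJ0 : 0 < J := by positivity
  refine ⟨J / (2 * Real.pi), by positivity, fun σ hσ hsad => ?_⟩
  have hlim := hsaddle.comp hσ
  have hpos : ∀ᶠ n in atTop, 0 < σ n := hσ.eventually self_mem_nhdsWithin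
  have hlim2 : Tendsto (fun n => (((2 * Real.pi) * (b n / (σ n ^ (1 + r / 2) *
      Real.exp (A * (1 + r) * σ n ^ (-r)))) : ℝ) : ℂ)) atTop (nhds (J : ℂ)) := by
    refine hlim.congr' ?_
    filter_upwards [hpos, hsad] with n hn hn2
    have hcoef := two_pi_mul_coeff_eq_integral (c := fun m => (l m : ℂ)) (b := fun m => (b m : ℂ))
      (fun ρ h0 h1 => summable_coeff_mul_pow hl h0 h1) (by simp [hl0]) (by simp [hb0])
      (fun n => by exact_mod_cast hrec n) hn n
    have hcongr : ∫ θ in -Real.pi..Real.pi,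
        Complex.exp (A * ((σ n : ℂ) - θ * Complex.I) ^ (-(r : ℂ)) +
          R (σ n - θ * Complex.I) + (r * A * σ n ^ (-r - 1) : ℝ) * (σ n - θ * Complex.I)) =
        2 * Real.pi * b n := by
      rw [hcoef]
      refine intervalIntegral.integral_congr fun θ _ => ?_
      rw [hseries _ (by simpa using hn), hn2, Complex.ofReal_natCast]
    simp only [Function.comp]
    rw [hcongr]
    push_cast
    ring
  have hlim3 := (Complex.continuous_re.tendsto _).comp hlim2
  simp only [Function.comp_def, Complex.ofReal_re] at hlim3
  have hlim4 := hlim3.div_const (2 * Real.pi)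
  refine hlim4.congr fun n => ?_
  rw [mul_div_cancel_left₀ _ (by positivity)]

/-! ### The saddle points in terms of `n`. -/

theorem theorem3 (a : ℕ → ℕ) (K r y ν : ℝ) (hK : 0 < K) (hr : 0 < r) (hy : 1 < y)
    (hν0 : 0 < ν) (hν1 : ν < 1)
    (ha : (fun j : ℕ => (a j : ℝ) - K * (j : ℝ) ^ (r - 1) * y ^ j)
      =O[atTop] fun j : ℕ => y ^ (ν * (j : ℝ))) :
    ∃ κ₁ κ₂ : ℝ, 0 < κ₁ ∧ 0 < κ₂ ∧
      κ₂ = (r + 1) / r * (K * Real.Gamma (r + 1)) ^ (1 / (r + 1)) ∧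
      (fun n : ℕ => (multisetCount a n : ℝ)) ~[atTop]
        fun n : ℕ => κ₁ * y ^ n * (n : ℝ) ^ (-((r + 2) / (2 * (r + 1)))) *
          Real.exp (κ₂ * (n : ℝ) ^ (r / (r + 1))) := by
  have hy0 : 0 < y := by linarith
  have hr1 : 0 < r + 1 := by linarith
  obtain ⟨L, hL, hlim⟩ := exists_tendsto_coeff_along_saddle
    (l := fun m : ℕ => ((∑ j ∈ m.divisors, j * a j : ℕ) : ℝ) / (m * y ^ m))
    (b := fun n : ℕ => (multisetCount a n : ℝ) / y ^ n) hK hr (by simp)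
    (summable_log_coeff_sub hy hν1 ha) (by simp [multisetCount_zero])
    (fun n => rescaled_recurrence a hy0 n)
  set W := K * Real.Gamma (r + 1) with hW
  have hW0 : 0 < W := mul_pos hK (Real.Gamma_pos_of_pos hr1)
  have hWA : r * (K * Real.Gamma r) = W := by
    rw [hW, Real.Gamma_add_one hr.ne']
    ring
  have hbase : Tendsto (fun n : ℕ => W / (n : ℝ)) atTop (nhds 0) :=
    tendsto_const_div_atTop_nhds_zero_nat W
  -- This `σ` solves `W σ ^ (-r - 1) = n`, the saddle point equation, since `r K Γ(r) = W`.
  have hσ : Tendsto (fun n : ℕ => (W / (n : ℝ)) ^ (1 / (r + 1))) atTop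
      (nhdsWithin 0 (Set.Ioi 0)) := by
    refine tendsto_nhdsWithin_of_tendsto_nhds_of_eventually_within _ ?_ ?_
    · have h := hbase.rpow_const (p := 1 / (r + 1)) (Or.inr (by positivity))
      rwa [Real.zero_rpow (by positivity)] at h
    · filter_upwards [eventually_gt_atTop 0] with n hn
      have : (0 : ℝ) < n := by exact_mod_cast hn
      exact Real.rpow_pos_of_pos (by positivity) _
  have hlim' := hlim _ hσ (by
    filter_upwards [eventually_gt_atTop 0] with n hn
    have hn' : (0 : ℝ) < n := by exact_mod_cast hn
    rw [hWA, ← Real.rpow_mul (by positivity),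
      show 1 / (r + 1) * (-r - 1) = -1 by field_simp; ring, Real.rpow_neg_one]
    field_simp)
  have hWp : 0 < W ^ ((r + 2) / (2 * (r + 1))) := by positivity
  refine ⟨L * W ^ ((r + 2) / (2 * (r + 1))), (r + 1) / r * W ^ (1 / (r + 1)), by positivity,
    by positivity, rfl, ?_⟩
  rw [isEquivalent_iff_tendsto_one]
  · have h1 := hlim'.div_const L
    rw [div_self hL.ne'] at h1
    refine h1.congr' ?_
    filter_upwards [eventually_gt_atTop 0] with n hn
    have hn' : (0 : ℝ) < n := by exact_mod_cast hn
    have h2 : ((W / (n : ℝ)) ^ (1 / (r + 1))) ^ (1 + r / 2) =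
        W ^ ((r + 2) / (2 * (r + 1))) * (n : ℝ) ^ (-((r + 2) / (2 * (r + 1)))) := by
      rw [← Real.rpow_mul (by positivity), Real.div_rpow hW0.le hn'.le, Real.rpow_neg hn'.le,
        div_eq_mul_inv, show 1 / (r + 1) * (1 + r / 2) = (r + 2) / (2 * (r + 1)) by
          field_simp; ring]
    -- Here `K Γ(r) = W / r` and `W * W ^ (-r / (r + 1)) = W ^ (1 / (r + 1))`, which is the origin
    -- of `κ₂`.
    have h3 : K * Real.Gamma r * (1 + r) * ((W / (n : ℝ)) ^ (1 / (r + 1))) ^ (-r) =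
        (r + 1) / r * W ^ (1 / (r + 1)) * (n : ℝ) ^ (r / (r + 1)) := by
      have h4 : ((W / (n : ℝ)) ^ (1 / (r + 1))) ^ (-r) =
          W ^ (-(r / (r + 1))) * (n : ℝ) ^ (r / (r + 1)) := by
        rw [← Real.rpow_mul (by positivity), show 1 / (r + 1) * -r = -(r / (r + 1)) by ring,
          Real.div_rpow hW0.le hn'.le, Real.rpow_neg hn'.le, div_inv_eq_mul]
      have h5 : W ^ (1 / (r + 1)) = W * W ^ (-(r / (r + 1))) := by
        rw [← Real.rpow_one_add' hW0.le]
        · congr 1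
          field_simp
          ring
        · have : 1 + -(r / (r + 1)) = 1 / (r + 1) := by
            field_simp
            ring
          rw [this]
          positivity
      rw [h4, h5, ← hWA]
      field_simp
      ring
    rw [h2, h3]
    simp only [Pi.div_apply]
    field_simp
  · filter_upwards [eventually_gt_atTop 0] with n hn
    have hn' : (0 : ℝ) < n := by exact_mod_cast hn
    positivity
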